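/- **Theorem 1.3.** A $3$-uniform multi-hypergraph $H$ consists of a finite vertex set $V(H)$ and a finite multiset of edges, each a $3$-element subset of $V(H)$; all edge counts below are with multiplicity. Let $e(H)$ be the number of edges of $H$, let $\mathrm{mc}_3(H)$ be the maximum, over all partitions $V(H)=V_1\cup V_2\cup V_3$, of the number of edges having at least one vertex in each of $V_1,V_2,V_3$, and let $$\mathrm{surp}_3(H)=\mathrm{mc}_3(H)-\frac{2}{9}\,e(H).$$ For $S\subseteq V(H)$, the induced subhypergraph $H[S]$ has as its edges all edges of $H$ contained in $S$, with their multiplicities. The degree of a vertex is the number of edges containing it, and the co-degree of a pair of distinct vertices is the number of edges containing both of them. There exists an absolute constant $c>0$ such that the following holds. Let $H$ be a $3$-uniform multi-hypergraph and let $S\subseteq V(H)$ be such that $H[S]$ has $m\ge 2$ edges, maximum degree $\Delta$ and maximum co-degree $D$. Then $$\mathrm{surp}_3(H)\ \ge\ c\cdot\frac{m}{\sqrt{\Delta D}\,(\log m)^2}.$$ -/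

import Mathlib

/-- A finite `r`-uniform multi-hypergraph with vertex set `V`: a finite multiset of edges, each
of which is a set of exactly `r` vertices. The same `r`-set may occur several times as an edge. -/
structure MultiHypergraph (r : ℕ) (V : Type*) where
  /-- The multiset of edges. -/
  edges : Multiset (Finset V)
  /-- Every edge has exactly `r` vertices. -/
  uniform : ∀ e ∈ edges, e.card = r

namespace MultiHypergraph

variable {r : ℕ} {V : Type*}

/-- The number of edges `e(H)`, counted with multiplicity. -/
def numEdges (H : MultiHypergraph r V) : ℕ :=
  Multiset.card H.edges

/-- The subhypergraph `H[S]` induced by `S`: its edges are all edges of `H`, with their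
multiplicities, that are contained in `S`. It is kept on the vertex type `V`; the vertices outside
`S` lie in no edge of it, so they do not affect the maximum degree and the maximum co-degree. -/
def induce [DecidableEq V] (H : MultiHypergraph r V) (S : Finset V) : MultiHypergraph r V where
  edges := H.edges.filter (fun e => e ⊆ S)
  uniform := fun e he => H.uniform e (Multiset.mem_of_mem_filter he)

/-- The degree of `v`: the number of edges containing `v`, counted with multiplicity. -/
def degree [DecidableEq V] (H : MultiHypergraph r V) (v : V) : ℕ :=
  H.edges.countP (fun e => v ∈ e)

/-- The co-degree of `u` and `v`: the number of edges containing both, counted with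
multiplicity. -/
def codegree [DecidableEq V] (H : MultiHypergraph r V) (u v : V) : ℕ :=
  H.edges.countP (fun e => u ∈ e ∧ v ∈ e)

/-- The maximum degree. -/
def maxDegree [Fintype V] [DecidableEq V] (H : MultiHypergraph r V) : ℕ :=
  Finset.univ.sup (fun v : V => H.degree v)

/-- The maximum co-degree, over all pairs of distinct vertices. -/
def maxCodegree [Fintype V] [DecidableEq V] (H : MultiHypergraph r V) : ℕ :=
  (Finset.univ : Finset V).offDiag.sup (fun p => H.codegree p.1 p.2)

/-- The size `e(V_1, …, V_k)` of the `k`-cut given by the partition of the vertex set into the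
parts `V_i = {v | f v = i}`: the number of edges, counted with multiplicity, that have at least one
vertex in each of the `k` parts. -/
def cutSize {k : ℕ} (H : MultiHypergraph r V) (f : V → Fin k) : ℕ :=
  H.edges.countP (fun e => ∀ i : Fin k, ∃ v ∈ e, f v = i)

/-- The Max-`k`-Cut `mc_k(H)`: the maximum size of a `k`-cut. (A partition with an empty part cuts
no edge when `k` is positive, so allowing empty parts does not change the maximum.) -/
def maxCut [Fintype V] [DecidableEq V] (k : ℕ) (H : MultiHypergraph r V) : ℕ :=
  (Finset.univ : Finset (V → Fin k)).sup (fun f => H.cutSize f)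

/-- The `k`-surplus `surp_k(H) = mc_k(H) - (S(r,k) k! / k^r) e(H)`, where `S(r,k)` is the Stirling
number of the second kind. -/
noncomputable def surplus [Fintype V] [DecidableEq V] (k : ℕ) (H : MultiHypergraph r V) : ℝ :=
  (H.maxCut k : ℝ) -
    ((Nat.stirlingSecond r k : ℝ) * (Nat.factorial k : ℝ) / (k : ℝ) ^ r) * (H.numEdges : ℝ)

end MultiHypergraph

/-! A random tripartition whose vertices are placed independently and, on average, uniformly cuts
each edge with probability 2/9; the gain comes from correlating the choice between the first two
parts. Each vertex of `S` becomes, with probability 2/3, a candidate: a fair sign `ε v` decides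
whether it joins the third part, and if not it goes to either of the first two by a fair coin. The
other vertices of `S` are always in the first two parts. Vertices outside `S` are placed uniformly
and independently.

Let `L v` be the link of a candidate `v` on the non-candidates and `Y = ∑ ε v • L v`. The
non-candidates are split by the signs of a Gaussian vector with covariance `1 - Y / l`. A pair `u,
w` with large `Y u w` lies in many edges whose third vertex is already in the third part, and it
tends to be separated. With `G` for `gaussianSignCorr`, the gain is a multiple of `∑ Y u w * G (Y u
w / l)` plus a term odd in `ε` that averages out. As `t * G t` is at least a constant times `t ^ 2`,
the mean gain is of order `(1 / l) * ∑ (L v u w) ^ 2`, hence at least of order `m / l`.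

The covariance is admissible once the eigenvalues of `Y` are at most `l`. The noncommutative
Khintchine inequality `sum_trace_signSum_pow_le` is used at moment order about `2 * log m`, with `∑
L v ^ 2` bounded by `2ΔD`. Its base is the second moment, at most `6mD`, instead of a dimension
factor, so the logarithm involves `m` and not the number of vertices. Thus `l` of order `√(ΔD log
m)` works for all but 1/12 of the signs, and the rest use no correlation.
`add_sum_sq_weightedLink_le_maxCut` carries out the rounding and `mul_div_le_surplus` the choice of
candidates. -/

/-! ### Sign correlations of Gaussian vectors. -/

section GaussianRounding

open MeasureTheory ProbabilityTheory Matrix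

theorem Real.abs_sign_le_one (x : ℝ) : |Real.sign x| ≤ 1 := by
  rcases Real.sign_apply_eq x with h | h | h <;> simp [h]

theorem Real.measurable_sign : Measurable Real.sign :=
  Measurable.ite measurableSet_Iio measurable_const
    (Measurable.ite measurableSet_Ioi measurable_const measurable_const)

theorem Real.sign_add_sign_nonneg {x y : ℝ} (h : 0 ≤ x + y) :
    0 ≤ Real.sign x + Real.sign y := by
  rcases lt_trichotomy x 0 with hx | hx | hx <;> rcases lt_trichotomy y 0 with hy | hy | hy <;>
    simp [hx, hy, Real.sign_of_neg, Real.sign_of_pos] <;> linarith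

theorem charFunDual_multivariateGaussian_map_pair {ι : Type*} [Fintype ι] [DecidableEq ι]
    (S : Matrix ι ι ℝ) (a b : EuclideanSpace ℝ ι) (L : StrongDual ℝ (ℝ × ℝ)) :
    charFunDual ((multivariateGaussian 0 S).map (fun z => (inner ℝ z a, inner ℝ z b))) L =
      charFun (multivariateGaussian 0 S) (L (1, 0) • a + L (0, 1) • b) := by
  have hL : ∀ x y : ℝ, L (x, y) = x * L (1, 0) + y * L (0, 1) := by
    intro x y
    have : ((x, y) : ℝ × ℝ) = x • (1, 0) + y • (0, 1) := by simp
    rw [this, map_add, map_smul, map_smul, smul_eq_mul, smul_eq_mul]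
  rw [charFunDual_apply, charFun_apply, integral_map]
  · refine integral_congr_ae (Filter.Eventually.of_forall fun z => ?_)
    simp only [hL (inner ℝ z a), inner_add_right, inner_smul_right]
    congr 3
    ring
  · fun_prop
  · exact Continuous.aestronglyMeasurable (by fun_prop)

/-- The joint law of two linear forms of a centered Gaussian vector only depends on their
covariances. -/
theorem multivariateGaussian_map_pair_eq {ι κ : Type*} [Fintype ι] [DecidableEq ι] [Fintype κ]
    [DecidableEq κ] {S : Matrix ι ι ℝ} {T : Matrix κ κ ℝ} (hS : S.PosSemidef) (hT : T.PosSemidef)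
    (a b : EuclideanSpace ℝ ι) (a' b' : EuclideanSpace ℝ κ)
    (haa : a ⬝ᵥ S *ᵥ a = a' ⬝ᵥ T *ᵥ a') (hab : a ⬝ᵥ S *ᵥ b = a' ⬝ᵥ T *ᵥ b')
    (hba : b ⬝ᵥ S *ᵥ a = b' ⬝ᵥ T *ᵥ a') (hbb : b ⬝ᵥ S *ᵥ b = b' ⬝ᵥ T *ᵥ b') :
    (multivariateGaussian 0 S).map (fun z => (inner ℝ z a, inner ℝ z b)) =
      (multivariateGaussian 0 T).map (fun z => (inner ℝ z a', inner ℝ z b')) := by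
  apply Measure.ext_of_charFunDual
  ext L
  rw [charFunDual_multivariateGaussian_map_pair, charFunDual_multivariateGaussian_map_pair,
    charFun_multivariateGaussian hS, charFun_multivariateGaussian hT]
  congr 2
  · simp
  · simp only [WithLp.ofLp_add, WithLp.ofLp_smul, mulVec_add, mulVec_smul, dotProduct_add,
      add_dotProduct, dotProduct_smul, smul_dotProduct, haa, hab, hba, hbb]

theorem integral_multivariateGaussian_pair_eq {ι κ : Type*} [Fintype ι] [DecidableEq ι]
    [Fintype κ] [DecidableEq κ] {S : Matrix ι ι ℝ} {T : Matrix κ κ ℝ} (hS : S.PosSemidef)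
    (hT : T.PosSemidef) (a b : EuclideanSpace ℝ ι) (a' b' : EuclideanSpace ℝ κ)
    (haa : a ⬝ᵥ S *ᵥ a = a' ⬝ᵥ T *ᵥ a') (hab : a ⬝ᵥ S *ᵥ b = a' ⬝ᵥ T *ᵥ b')
    (hba : b ⬝ᵥ S *ᵥ a = b' ⬝ᵥ T *ᵥ a') (hbb : b ⬝ᵥ S *ᵥ b = b' ⬝ᵥ T *ᵥ b') :
    ∫ z, Real.sign (inner ℝ z a) * Real.sign (inner ℝ z b) ∂(multivariateGaussian 0 S) =
      ∫ z, Real.sign (inner ℝ z a') * Real.sign (inner ℝ z b') ∂(multivariateGaussian 0 T) := by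
  have h := multivariateGaussian_map_pair_eq hS hT a b a' b' haa hab hba hbb
  have hm : Measurable fun p : ℝ × ℝ => Real.sign p.1 * Real.sign p.2 :=
    (Real.measurable_sign.comp measurable_fst).mul (Real.measurable_sign.comp measurable_snd)
  have h1 := integral_map (μ := multivariateGaussian 0 S)
    (φ := fun z => ((inner ℝ z a : ℝ), (inner ℝ z b : ℝ))) (by fun_prop) hm.aestronglyMeasurable
  have h2 := integral_map (μ := multivariateGaussian 0 T)
    (φ := fun z => ((inner ℝ z a' : ℝ), (inner ℝ z b' : ℝ))) (by fun_prop) hm.aestronglyMeasurable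
  rw [← h1, ← h2, h]

/-- The expected product of the signs of two standard Gaussian variables of correlation `t`. -/
noncomputable def gaussianSignCorr (t : ℝ) : ℝ :=
  ∫ z, Real.sign (inner ℝ z !₂[1, 0]) * Real.sign (inner ℝ z !₂[t, √(1 - t ^ 2)])
    ∂(multivariateGaussian 0 (1 : Matrix (Fin 2) (Fin 2) ℝ))

theorem gaussianSignCorr_neg (t : ℝ) : gaussianSignCorr (-t) = -gaussianSignCorr t := by
  have h : gaussianSignCorr (-t) =
      ∫ z, Real.sign (inner ℝ z !₂[1, 0]) * Real.sign (inner ℝ z (-!₂[t, √(1 - t ^ 2)]))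
        ∂(multivariateGaussian 0 (1 : Matrix (Fin 2) (Fin 2) ℝ)) := by
    unfold gaussianSignCorr
    apply integral_multivariateGaussian_pair_eq PosSemidef.one PosSemidef.one <;>
      simp [dotProduct, Fin.sum_univ_two, add_comm]
  rw [h, gaussianSignCorr, ← integral_neg]
  refine integral_congr_ae (Filter.Eventually.of_forall fun z => ?_)
  simp only [inner_neg_right, Real.sign_neg, mul_neg]

theorem Matrix.PosSemidef.sq_apply_le_one {ι : Type*} [Fintype ι] [DecidableEq ι]
    {S : Matrix ι ι ℝ} (hS : S.PosSemidef) (hd : ∀ i, S i i = 1) (i j : ι) : S i j ^ 2 ≤ 1 := by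
  have hsymm : S j i = S i j := by simpa using congrFun₂ hS.1 i j
  have h1 := hS.dotProduct_mulVec_nonneg (Pi.single i 1 + Pi.single j 1)
  have h2 := hS.dotProduct_mulVec_nonneg (Pi.single i 1 - Pi.single j 1)
  simp [mulVec_add, mulVec_sub, hd, hsymm] at h1 h2
  rw [sq_le_one_iff_abs_le_one, abs_le]
  constructor <;> linarith

theorem integral_sign_mul_sign_multivariateGaussian {ι : Type*} [Fintype ι] [DecidableEq ι]
    {S : Matrix ι ι ℝ} (hS : S.PosSemidef) (hd : ∀ i, S i i = 1) (i j : ι) :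
    ∫ z, Real.sign (z i) * Real.sign (z j) ∂(multivariateGaussian 0 S) =
      gaussianSignCorr (S i j) := by
  have hsymm : S j i = S i j := by simpa using congrFun₂ hS.1 i j
  have hle : S i j ^ 2 ≤ 1 := hS.sq_apply_le_one hd i j
  have h := integral_multivariateGaussian_pair_eq hS (PosSemidef.one (n := Fin 2) (R := ℝ))
    (EuclideanSpace.single i 1) (EuclideanSpace.single j 1) !₂[1, 0]
    !₂[S i j, √(1 - S i j ^ 2)] (by simp [hd, dotProduct, Fin.sum_univ_two])
    (by simp [dotProduct, Fin.sum_univ_two]) (by simp [dotProduct, Fin.sum_univ_two, hsymm])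
    (by simp only [one_mulVec, dotProduct, Fin.sum_univ_two]
        simp [hd, Real.mul_self_sqrt (sub_nonneg.2 hle), ← sq])
  rw [gaussianSignCorr, ← h]
  refine integral_congr_ae (Filter.Eventually.of_forall fun z => ?_)
  simp [EuclideanSpace.inner_single_right]

theorem mul_le_gaussianReal_real_Ioo {a b : ℝ} (hab : a ≤ b) (ha : -2 ≤ a) (hb : b ≤ 2) :
    gaussianPDFReal 0 1 2 * (b - a) ≤ (gaussianReal 0 1).real (Set.Ioo a b) := by
  rw [measureReal_def, gaussianReal_apply_eq_integral 0 one_ne_zero, ENNReal.toReal_ofReal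
    (setIntegral_nonneg measurableSet_Ioo fun x _ => gaussianPDFReal_nonneg 0 1 x)]
  have h : ∫ _ in Set.Ioo a b, gaussianPDFReal 0 1 2 = gaussianPDFReal 0 1 2 * (b - a) := by
    simp [hab, mul_comm]
  rw [← h]
  refine setIntegral_mono_on (by simp) (integrable_gaussianPDFReal 0 1).integrableOn
    measurableSet_Ioo fun x hx => ?_
  simp only [gaussianPDFReal_def]
  have : x ^ 2 ≤ 2 ^ 2 := by nlinarith [hx.1, hx.2]
  refine mul_le_mul_of_nonneg_left (Real.exp_le_exp.2 ?_) (by positivity)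
  simp only [sub_zero, NNReal.coe_one, mul_one]
  linarith

/-- Reflecting the second coordinate does not change the law, so `2 * gaussianSignCorr t` is the
mean of a sum of two sign products. That sum is nonnegative everywhere and equals 2 on the box `(1,
2) × (-t, t)`, where the density bound at 2 applies to both coordinates. This linear bound replaces
the exact arcsine formula. -/
theorem two_mul_sq_mul_le_gaussianSignCorr {t : ℝ} (h0 : 0 ≤ t) (h1 : t ≤ 1) :
    2 * gaussianPDFReal 0 1 2 ^ 2 * t ≤ gaussianSignCorr t := by
  set P := multivariateGaussian 0 (1 : Matrix (Fin 2) (Fin 2) ℝ) with hP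
  set s := √(1 - t ^ 2) with hs
  have hs0 : 0 ≤ s := Real.sqrt_nonneg _
  have hs1 : s ≤ 1 := Real.sqrt_le_one.2 (by nlinarith)
  have hG : gaussianSignCorr t =
      ∫ z : EuclideanSpace ℝ (Fin 2), Real.sign (z 0) * Real.sign (t * z 0 + s * z 1) ∂P := by
    rw [gaussianSignCorr]
    refine integral_congr_ae (Filter.Eventually.of_forall fun z => ?_)
    simp [PiLp.inner_apply, Fin.sum_univ_two, hs]
  have hG' : gaussianSignCorr t =
      ∫ z : EuclideanSpace ℝ (Fin 2), Real.sign (z 0) * Real.sign (t * z 0 - s * z 1) ∂P := by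
    have h : gaussianSignCorr t =
        ∫ z, Real.sign (inner ℝ z !₂[1, 0]) * Real.sign (inner ℝ z !₂[t, -s]) ∂P := by
      unfold gaussianSignCorr
      apply integral_multivariateGaussian_pair_eq PosSemidef.one PosSemidef.one <;>
        simp [dotProduct, Fin.sum_univ_two, hs]
    rw [h]
    refine integral_congr_ae (Filter.Eventually.of_forall fun z => ?_)
    simp [PiLp.inner_apply, Fin.sum_univ_two, sub_eq_add_neg]
  have hint : ∀ f g : EuclideanSpace ℝ (Fin 2) → ℝ, Continuous f → Continuous g →
      Integrable (fun z => Real.sign (f z) * Real.sign (g z)) P := by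
    intro f g hf hg
    refine Integrable.of_bound (C := 1) (((Real.measurable_sign.comp hf.measurable).mul
      (Real.measurable_sign.comp hg.measurable)).aestronglyMeasurable)
      (Filter.Eventually.of_forall fun z => ?_)
    rw [Real.norm_eq_abs, abs_mul]
    exact mul_le_one₀ (Real.abs_sign_le_one _) (abs_nonneg _) (Real.abs_sign_le_one _)
  let box : Set (EuclideanSpace ℝ (Fin 2)) := {z | z 0 ∈ Set.Ioo 1 2 ∧ z 1 ∈ Set.Ioo (-t) t}
  have hbox : MeasurableSet box :=
    (measurableSet_Ioo.preimage (by fun_prop : Measurable fun z : EuclideanSpace ℝ (Fin 2) => z 0))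
      |>.inter (measurableSet_Ioo.preimage
        (by fun_prop : Measurable fun z : EuclideanSpace ℝ (Fin 2) => z 1))
  have hPbox : P.real box =
      (gaussianReal 0 1).real (Set.Ioo 1 2) * (gaussianReal 0 1).real (Set.Ioo (-t) t) := by
    rw [hP, multivariateGaussian_zero_one, ← map_pi_eq_stdGaussian, measureReal_def,
      Measure.map_apply (by fun_prop) hbox]
    have : (WithLp.toLp 2) ⁻¹' box =
        Set.univ.pi (![Set.Ioo 1 2, Set.Ioo (-t) t] : Fin 2 → Set ℝ) := by
      ext z
      simp [box, Set.mem_pi, Fin.forall_fin_two]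
    rw [this, Measure.pi_pi, Fin.prod_univ_two, ENNReal.toReal_mul]
    rfl
  have hpt : ∀ z : EuclideanSpace ℝ (Fin 2), box.indicator (fun _ => (2 : ℝ)) z ≤
      Real.sign (z 0) * Real.sign (t * z 0 + s * z 1) +
        Real.sign (z 0) * Real.sign (t * z 0 - s * z 1) := by
    intro z
    by_cases hz : z ∈ box
    · obtain ⟨⟨ha, _⟩, hb1, hb2⟩ := id hz
      have hsz : |s * z 1| < t * z 0 := by
        rw [abs_mul, abs_of_nonneg hs0]
        have : |z 1| < t := abs_lt.2 ⟨hb1, hb2⟩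
        nlinarith [abs_nonneg (z 1)]
      obtain ⟨h3, h4⟩ := abs_lt.1 hsz
      rw [Set.indicator_of_mem hz, Real.sign_of_pos (by linarith),
        Real.sign_of_pos (by linarith), Real.sign_of_pos (by linarith)]
      norm_num
    · rw [Set.indicator_of_notMem hz, ← mul_add]
      rcases lt_trichotomy (z 0) 0 with h | h | h
      · rw [Real.sign_of_neg h]
        have := Real.sign_add_sign_nonneg
          (x := -(t * z 0 + s * z 1)) (y := -(t * z 0 - s * z 1)) (by nlinarith)
        rw [Real.sign_neg, Real.sign_neg] at this
        linarith
      · simp [h]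
      · rw [Real.sign_of_pos h, one_mul]
        exact Real.sign_add_sign_nonneg (by nlinarith)
  have hsum := integral_mono (μ := P) ((integrable_const (2 : ℝ)).indicator hbox)
    ((hint (fun z => z 0) (fun z => t * z 0 + s * z 1) (by fun_prop) (by fun_prop)).add
      (hint (fun z => z 0) (fun z => t * z 0 - s * z 1) (by fun_prop) (by fun_prop))) hpt
  have hadd := integral_add
    (hint (fun z => z 0) (fun z => t * z 0 + s * z 1) (by fun_prop) (by fun_prop))
    (hint (fun z => z 0) (fun z => t * z 0 - s * z 1) (by fun_prop) (by fun_prop))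
  rw [← hG, ← hG'] at hadd
  rw [integral_indicator_const _ hbox, smul_eq_mul, hPbox] at hsum
  have e : 2 * gaussianSignCorr t = gaussianSignCorr t + gaussianSignCorr t := two_mul _
  have hsum' : (gaussianReal 0 1).real (Set.Ioo 1 2) * (gaussianReal 0 1).real (Set.Ioo (-t) t) * 2 ≤
      2 * gaussianSignCorr t := by
    rw [e, ← hadd]
    exact hsum
  have b1 := mul_le_gaussianReal_real_Ioo (a := 1) (b := 2) (by norm_num) (by norm_num) le_rfl
  have b2 := mul_le_gaussianReal_real_Ioo (a := -t) (b := t) (by linarith) (by linarith)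
    (by linarith)
  have b3 := mul_le_mul b1 b2 (mul_nonneg (gaussianPDFReal_nonneg _ _ _) (by linarith))
    measureReal_nonneg
  nlinarith

end GaussianRounding

/-! ### Trace inequalities for powers of symmetric matrices. -/

open Matrix in
theorem Matrix.IsHermitian.exists_orthogonal_diagonal {n : Type*} [Fintype n] [DecidableEq n]
    {U : Matrix n n ℝ} (hU : U.IsHermitian) :
    ∃ (P : Matrix n n ℝ) (l : n → ℝ), Pᵀ * P = 1 ∧ P * Pᵀ = 1 ∧
      ∀ q : ℕ, U ^ q = P * diagonal (fun i => l i ^ q) * Pᵀ := by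
  set P : Matrix n n ℝ := (hU.eigenvectorUnitary : Matrix n n ℝ) with hP
  have h1 : Pᵀ * P = 1 := by
    have := Unitary.star_mul_self_of_mem hU.eigenvectorUnitary.2
    simpa [star_eq_conjTranspose] using this
  have h2 : P * Pᵀ = 1 := by
    have := Unitary.mul_star_self_of_mem hU.eigenvectorUnitary.2
    simpa [star_eq_conjTranspose] using this
  have h3 : U = P * diagonal hU.eigenvalues * Pᵀ := by
    have := hU.spectral_theorem
    rw [Unitary.conjStarAlgAut_apply] at this
    simpa [star_eq_conjTranspose, Function.comp_def] using this
  refine ⟨P, hU.eigenvalues, h1, h2, fun q => ?_⟩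
  induction q with
  | zero => simp [h2]
  | succ k ih =>
    rw [pow_succ, ih]
    nth_rewrite 2 [h3]
    calc _ = P * diagonal (fun i => hU.eigenvalues i ^ k) * (Pᵀ * P) *
          diagonal hU.eigenvalues * Pᵀ := by simp only [Matrix.mul_assoc]
      _ = _ := by
        rw [h1, Matrix.mul_one, Matrix.mul_assoc P, diagonal_mul_diagonal]
        simp only [pow_succ]

/-- For nonnegative `x, y` the differences `x ^ q - y ^ q` and `x ^ (r - q) - y ^ (r - q)` have the
same sign; evenness of `r` allows passing to absolute values. -/
theorem pow_mul_pow_add_le {a b : ℝ} {q r : ℕ} (hr : Even r) (hq : q ≤ r) :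
    a ^ q * b ^ (r - q) + a ^ (r - q) * b ^ q ≤ a ^ r + b ^ r := by
  have key : ∀ x y : ℝ, 0 ≤ x → 0 ≤ y → 0 ≤ (x ^ q - y ^ q) * (x ^ (r - q) - y ^ (r - q)) := by
    intro x y hx hy
    rcases le_total x y with h | h
    · exact mul_nonneg_of_nonpos_of_nonpos (sub_nonpos.2 (pow_le_pow_left₀ hx h _))
        (sub_nonpos.2 (pow_le_pow_left₀ hx h _))
    · exact mul_nonneg (sub_nonneg.2 (pow_le_pow_left₀ hy h _))
        (sub_nonneg.2 (pow_le_pow_left₀ hy h _))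
  have h := key |a| |b| (abs_nonneg _) (abs_nonneg _)
  have e1 : ∀ x : ℝ, |x| ^ q * |x| ^ (r - q) = x ^ r := fun x => by
    rw [← pow_add, Nat.add_sub_cancel' hq, hr.pow_abs]
  have h1 : a ^ q * b ^ (r - q) ≤ |a| ^ q * |b| ^ (r - q) := by
    rw [← abs_pow, ← abs_pow, ← abs_mul]; exact le_abs_self _
  have h2 : a ^ (r - q) * b ^ q ≤ |a| ^ (r - q) * |b| ^ q := by
    rw [← abs_pow, ← abs_pow, ← abs_mul]; exact le_abs_self _
  nlinarith [e1 a, e1 b]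

-- In eigenbases of `U` and `W` each trace is a sum of monomials in the eigenvalues with nonnegative
-- weights `K i j ^ 2`. Pairing `q` with `r - q` reduces the claim to the scalar inequality
-- `pow_mul_pow_add_le`.
open Matrix in
theorem Matrix.sum_trace_mul_pow_mul_pow_le {n : Type*} [Fintype n] [DecidableEq n]
    {A U W : Matrix n n ℝ} (hA : A.IsHermitian) (hU : U.IsHermitian) (hW : W.IsHermitian)
    {r : ℕ} (hr : Even r) :
    ∑ q ∈ Finset.range (r + 1), (A * U ^ q * A * W ^ (r - q)).trace ≤
      ((r : ℝ) + 1) / 2 * ((A * A * U ^ r).trace + (A * A * W ^ r).trace) := by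
  obtain ⟨P, l, hP1, hP2, hP⟩ := hU.exists_orthogonal_diagonal
  obtain ⟨R, k, hR1, hR2, hR⟩ := hW.exists_orthogonal_diagonal
  have hAt : Aᵀ = A := by simpa [Matrix.IsHermitian] using hA
  set K : Matrix n n ℝ := Pᵀ * A * R with hK
  have key : ∀ q s : ℕ, (A * U ^ q * A * W ^ s).trace =
      ∑ i, ∑ j, K i j ^ 2 * (l i ^ q * k j ^ s) := by
    intro q s
    have : A * U ^ q * A * W ^ s =
        (A * P) * (diagonal (fun i => l i ^ q) * K * diagonal (fun i => k i ^ s)) * Rᵀ := by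
      rw [hP, hR, hK]; simp only [Matrix.mul_assoc]
    have hKt : Kᵀ = Rᵀ * (A * P) := by
      rw [hK]; simp [Matrix.transpose_mul, hAt, Matrix.mul_assoc]
    rw [this, Matrix.trace_mul_comm, ← Matrix.mul_assoc, ← hKt, Matrix.trace]
    simp only [diag_apply, Matrix.mul_apply, transpose_apply]
    rw [Finset.sum_comm]
    refine Finset.sum_congr rfl fun i _ => Finset.sum_congr rfl fun j _ => ?_
    simp only [diagonal_apply, mul_ite, mul_zero, ite_mul, zero_mul, Finset.sum_ite_eq,
      Finset.sum_ite_eq', Finset.mem_univ, if_true]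
    ring
  have e1 : (A * A * U ^ r).trace = ∑ i, ∑ j, K i j ^ 2 * l i ^ r := by
    have := key r 0
    rw [pow_zero, Matrix.mul_one, Matrix.trace_mul_comm, ← Matrix.mul_assoc] at this
    simpa using this
  have e2 : (A * A * W ^ r).trace = ∑ i, ∑ j, K i j ^ 2 * k j ^ r := by
    simpa using key 0 r
  have hswap : ∑ q ∈ Finset.range (r + 1), (A * U ^ q * A * W ^ (r - q)).trace =
      ∑ q ∈ Finset.range (r + 1), (A * U ^ (r - q) * A * W ^ q).trace := by
    rw [← Finset.sum_range_reflect]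
    refine Finset.sum_congr rfl fun q hq => ?_
    have : q ≤ r := Nat.lt_succ_iff.1 (Finset.mem_range.1 hq)
    congr 3
    omega
  have hdouble : 2 * ∑ q ∈ Finset.range (r + 1), (A * U ^ q * A * W ^ (r - q)).trace ≤
      ∑ q ∈ Finset.range (r + 1), ((A * A * U ^ r).trace + (A * A * W ^ r).trace) := by
    rw [two_mul]
    nth_rewrite 2 [hswap]
    rw [← Finset.sum_add_distrib]
    refine Finset.sum_le_sum fun q hq => ?_
    rw [key, key, e1, e2, ← Finset.sum_add_distrib, ← Finset.sum_add_distrib]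
    refine Finset.sum_le_sum fun i _ => ?_
    rw [← Finset.sum_add_distrib, ← Finset.sum_add_distrib]
    refine Finset.sum_le_sum fun j _ => ?_
    rw [← mul_add, ← mul_add]
    exact mul_le_mul_of_nonneg_left
      (pow_mul_pow_add_le hr (Nat.lt_succ_iff.1 (Finset.mem_range.1 hq))) (sq_nonneg _)
  rw [Finset.sum_const, Finset.card_range, nsmul_eq_mul] at hdouble
  push_cast at hdouble
  linarith

theorem pow_succ_sub_pow_succ_eq_sum {R : Type*} [Ring R] (U W : R) (r : ℕ) :
    U ^ (r + 1) - W ^ (r + 1) = ∑ q ∈ Finset.range (r + 1), U ^ q * (U - W) * W ^ (r - q) := by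
  have h : ∀ q ∈ Finset.range (r + 1), U ^ q * (U - W) * W ^ (r - q) =
      U ^ (q + 1) * W ^ (r + 1 - (q + 1)) - U ^ q * W ^ (r + 1 - q) := by
    intro q hq
    have : r + 1 - q = (r - q) + 1 := by have := Finset.mem_range.1 hq; omega
    rw [this, pow_succ U q, pow_succ' W (r - q), Nat.add_sub_add_right]
    noncomm_ring
  rw [Finset.sum_congr rfl h, Finset.sum_range_sub (fun q => U ^ q * W ^ (r + 1 - q))]
  simp

/-! ### Noncommutative Khintchine inequality and its consequences. -/

/-- The signed sum of a family of matrices. -/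
noncomputable def signSum {κ n : Type*} [Fintype κ] (L : κ → Matrix n n ℝ) (ε : κ → ℤˣ) :
    Matrix n n ℝ :=
  ∑ v, ((ε v : ℤ) : ℝ) • L v

theorem Int.units_coe_real_mul_self (u : ℤˣ) : ((u : ℤ) : ℝ) * ((u : ℤ) : ℝ) = 1 := by
  rcases Int.units_eq_one_or u with h | h <;> simp [h]

/-- Changing the sign at one coordinate. -/
def flipSign {κ : Type*} [DecidableEq κ] (v : κ) : (κ → ℤˣ) ≃ (κ → ℤˣ) :=
  Function.Involutive.toPerm (fun ε => Function.update ε v (-ε v)) (fun ε => by simp)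

theorem flipSign_apply {κ : Type*} [DecidableEq κ] (v : κ) (ε : κ → ℤˣ) :
    flipSign v ε = Function.update ε v (-ε v) := rfl

section Khintchine

variable {κ n : Type*} [Fintype κ]

theorem signSum_isHermitian {L : κ → Matrix n n ℝ} (hL : ∀ v, (L v).IsHermitian)
    (ε : κ → ℤˣ) : (signSum L ε).IsHermitian := by
  unfold signSum Matrix.IsHermitian
  rw [Matrix.conjTranspose_sum]
  refine Finset.sum_congr rfl fun v _ => ?_
  rw [Matrix.conjTranspose_smul, (hL v).eq]
  simp

theorem signSum_neg (L : κ → Matrix n n ℝ) (ε : κ → ℤˣ) : signSum L (-ε) = -signSum L ε := by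
  simp [signSum]

variable [DecidableEq κ]

theorem signSum_sub_signSum_flipSign (L : κ → Matrix n n ℝ) (v : κ) (ε : κ → ℤˣ) :
    signSum L ε - signSum L (flipSign v ε) = (2 * ((ε v : ℤ) : ℝ)) • L v := by
  unfold signSum
  rw [← Finset.sum_sub_distrib, Finset.sum_eq_single v]
  · rw [flipSign_apply, Function.update_self, ← sub_smul]
    congr 1
    push_cast
    ring
  · intro w _ hw
    rw [flipSign_apply, Function.update_of_ne hw, sub_self]
  · simp

variable [Fintype n] [DecidableEq n]

open Matrix in
theorem Matrix.trace_mul_pow_two_mul_le {V Y : Matrix n n ℝ} {s : ℝ} (hY : Y.IsHermitian)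
    (hV : ∀ x : n → ℝ, x ⬝ᵥ (V *ᵥ x) ≤ s * (x ⬝ᵥ x)) (p : ℕ) :
    (V * Y ^ (2 * p)).trace ≤ s * (Y ^ (2 * p)).trace := by
  have hZ : ((Y ^ p)ᵀ : Matrix n n ℝ) = Y ^ p := by
    have : Yᵀ = Y := by simpa [Matrix.IsHermitian] using hY
    rw [Matrix.transpose_pow, this]
  set Z := Y ^ p
  have e : Y ^ (2 * p) = Z * Zᵀ := by rw [hZ, two_mul, pow_add]
  have e1 : (V * (Z * Zᵀ)).trace = ∑ j, Z.col j ⬝ᵥ (V *ᵥ Z.col j) := by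
    rw [← Matrix.mul_assoc, Matrix.trace_mul_comm, Matrix.trace]
    refine Finset.sum_congr rfl fun j _ => ?_
    simp [Matrix.mul_apply, dotProduct, mulVec, Matrix.col]
  have e2 : (Z * Zᵀ).trace = ∑ j, Z.col j ⬝ᵥ Z.col j := by
    rw [Matrix.trace_mul_comm, Matrix.trace]
    refine Finset.sum_congr rfl fun j _ => ?_
    simp [Matrix.mul_apply, dotProduct, Matrix.col]
  rw [e, e1, e2, Finset.mul_sum]
  exact Finset.sum_le_sum fun j _ => hV _

-- Discrete integration by parts: one factor of the power is expanded as `∑ ε v • L v`, and each `ε`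
-- is paired with its flip at `v`. The difference of the two odd powers telescopes into terms
-- containing `L v` twice, which the trace inequality collects into `L v * L v`.
open Matrix in
theorem sum_trace_signSum_pow_succ_le {L : κ → Matrix n n ℝ} (hL : ∀ v, (L v).IsHermitian)
    {s : ℝ} (hs : ∀ x : n → ℝ, x ⬝ᵥ ((∑ v, L v * L v) *ᵥ x) ≤ s * (x ⬝ᵥ x)) (p : ℕ) :
    ∑ ε : κ → ℤˣ, (signSum L ε ^ (2 * (p + 1))).trace ≤
      (2 * p + 1) * s * ∑ ε : κ → ℤˣ, (signSum L ε ^ (2 * p)).trace := by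
  have expand : ∀ ε : κ → ℤˣ, (signSum L ε ^ (2 * (p + 1))).trace =
      ∑ v, ((ε v : ℤ) : ℝ) * (L v * signSum L ε ^ (2 * p + 1)).trace := by
    intro ε
    rw [show 2 * (p + 1) = (2 * p + 1) + 1 by ring, pow_succ']
    nth_rewrite 1 [signSum]
    rw [Finset.sum_mul, Matrix.trace_sum]
    simp
  have single : ∀ v, ∑ ε : κ → ℤˣ, ((ε v : ℤ) : ℝ) * (L v * signSum L ε ^ (2 * p + 1)).trace ≤
      (2 * p + 1) * ∑ ε : κ → ℤˣ, (L v * L v * signSum L ε ^ (2 * p)).trace := by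
    intro v
    have h1 : ∑ ε : κ → ℤˣ, ((ε v : ℤ) : ℝ) * (L v * signSum L ε ^ (2 * p + 1)).trace =
        -∑ ε : κ → ℤˣ, ((ε v : ℤ) : ℝ) *
          (L v * signSum L (flipSign v ε) ^ (2 * p + 1)).trace := by
      rw [← Equiv.sum_comp (flipSign v), ← Finset.sum_neg_distrib]
      refine Finset.sum_congr rfl fun ε _ => ?_
      rw [flipSign_apply, Function.update_self]
      push_cast
      ring
    have h2 : ∑ ε : κ → ℤˣ, (L v * L v * signSum L (flipSign v ε) ^ (2 * p)).trace =
        ∑ ε : κ → ℤˣ, (L v * L v * signSum L ε ^ (2 * p)).trace :=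
      Equiv.sum_comp (flipSign v) fun ε => (L v * L v * signSum L ε ^ (2 * p)).trace
    have h3 : ∀ ε : κ → ℤˣ, ((ε v : ℤ) : ℝ) * (L v * signSum L ε ^ (2 * p + 1)).trace -
        ((ε v : ℤ) : ℝ) * (L v * signSum L (flipSign v ε) ^ (2 * p + 1)).trace ≤
        (2 * p + 1) * ((L v * L v * signSum L ε ^ (2 * p)).trace +
          (L v * L v * signSum L (flipSign v ε) ^ (2 * p)).trace) := by
      intro ε
      have h4 := sum_trace_mul_pow_mul_pow_le (hL v) (signSum_isHermitian hL ε)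
        (signSum_isHermitian hL (flipSign v ε)) (even_two_mul p)
      have h5 : ((ε v : ℤ) : ℝ) * (L v * signSum L ε ^ (2 * p + 1)).trace -
          ((ε v : ℤ) : ℝ) * (L v * signSum L (flipSign v ε) ^ (2 * p + 1)).trace =
          2 * ∑ q ∈ Finset.range (2 * p + 1),
            (L v * signSum L ε ^ q * L v * signSum L (flipSign v ε) ^ (2 * p - q)).trace := by
        rw [← mul_sub, ← Matrix.trace_sub, ← Matrix.mul_sub, pow_succ_sub_pow_succ_eq_sum,
          signSum_sub_signSum_flipSign, Finset.mul_sum, Matrix.trace_sum, Finset.mul_sum,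
          Finset.mul_sum]
        refine Finset.sum_congr rfl fun q _ => ?_
        rw [Matrix.mul_smul, Matrix.smul_mul, Matrix.mul_smul, Matrix.trace_smul, smul_eq_mul,
          ← mul_assoc, mul_left_comm, Int.units_coe_real_mul_self, mul_one]
        simp only [Matrix.mul_assoc]
      rw [h5]
      push_cast at h4
      linarith
    have h6 := Finset.sum_le_sum fun (ε : κ → ℤˣ) (_ : ε ∈ Finset.univ) => h3 ε
    rw [Finset.sum_sub_distrib, ← Finset.mul_sum, Finset.sum_add_distrib, h2] at h6
    linarith
  simp_rw [expand]
  rw [Finset.sum_comm]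
  refine (Finset.sum_le_sum fun v _ => single v).trans ?_
  rw [← Finset.mul_sum, Finset.sum_comm, mul_assoc]
  refine mul_le_mul_of_nonneg_left ?_ (by positivity)
  rw [Finset.mul_sum]
  refine Finset.sum_le_sum fun ε _ => ?_
  rw [← Matrix.trace_sum, ← Finset.sum_mul]
  exact trace_mul_pow_two_mul_le (signSum_isHermitian hL ε) hs p

open Matrix in
theorem Matrix.IsHermitian.trace_pow_two_mul_nonneg {Y : Matrix n n ℝ} (hY : Y.IsHermitian)
    (q : ℕ) : 0 ≤ (Y ^ (2 * q)).trace := by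
  have : ((Y ^ q)ᵀ) = Y ^ q := by
    have : Yᵀ = Y := by simpa [Matrix.IsHermitian] using hY
    rw [Matrix.transpose_pow, this]
  rw [two_mul, pow_add]
  nth_rewrite 2 [← this]
  rw [Matrix.trace]
  exact Finset.sum_nonneg fun i _ => by
    simp only [diag_apply, Matrix.mul_apply, transpose_apply]
    exact Finset.sum_nonneg fun j _ => mul_self_nonneg _

open Matrix in
/-- Noncommutative Khintchine inequality for signed sums of symmetric matrices. -/
theorem sum_trace_signSum_pow_le {L : κ → Matrix n n ℝ} (hL : ∀ v, (L v).IsHermitian)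
    {s : ℝ} (hs0 : 0 ≤ s) (hs : ∀ x : n → ℝ, x ⬝ᵥ ((∑ v, L v * L v) *ᵥ x) ≤ s * (x ⬝ᵥ x))
    (p : ℕ) :
    ∑ ε : κ → ℤˣ, (signSum L ε ^ (2 * (p + 1))).trace ≤
      (2 * (p + 1) * s) ^ p * ∑ ε : κ → ℤˣ, (signSum L ε ^ 2).trace := by
  have nonneg : ∀ q : ℕ, 0 ≤ ∑ ε : κ → ℤˣ, (signSum L ε ^ (2 * q)).trace := fun q =>
    Finset.sum_nonneg fun ε _ => (signSum_isHermitian hL ε).trace_pow_two_mul_nonneg q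
  have main : ∀ q, q ≤ p → ∑ ε : κ → ℤˣ, (signSum L ε ^ (2 * (q + 1))).trace ≤
      (2 * (p + 1) * s) ^ q * ∑ ε : κ → ℤˣ, (signSum L ε ^ 2).trace := by
    intro q
    induction q with
    | zero => simp
    | succ q ih =>
      intro hq
      refine (sum_trace_signSum_pow_succ_le hL hs (q + 1)).trans ?_
      rw [pow_succ', mul_assoc (2 * ((p : ℝ) + 1) * s)]
      refine mul_le_mul ?_ (ih (by omega)) (nonneg _) (by positivity)
      refine mul_le_mul_of_nonneg_right ?_ hs0
      have : ((q : ℝ) + 1) ≤ p := by exact_mod_cast hq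
      push_cast
      linarith
  exact main p le_rfl

theorem sum_sq_sum_sign_mul (l : κ → ℝ) :
    ∑ ε : κ → ℤˣ, (∑ v, ((ε v : ℤ) : ℝ) * l v) ^ 2 = 2 ^ Fintype.card κ * ∑ v, l v ^ 2 := by
  have h : ∀ v w, ∑ ε : κ → ℤˣ, (((ε v : ℤ) : ℝ) * l v) * (((ε w : ℤ) : ℝ) * l w) =
      if v = w then 2 ^ Fintype.card κ * l v ^ 2 else 0 := by
    intro v w
    split_ifs with hvw
    · subst hvw
      have : ∀ ε : κ → ℤˣ, (((ε v : ℤ) : ℝ) * l v) * (((ε v : ℤ) : ℝ) * l v) = l v ^ 2 := by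
        intro ε
        linear_combination l v ^ 2 * Int.units_coe_real_mul_self (ε v)
      simp [this]
    · have h1 : ∑ ε : κ → ℤˣ, (((ε v : ℤ) : ℝ) * l v) * (((ε w : ℤ) : ℝ) * l w) =
          -∑ ε : κ → ℤˣ, (((ε v : ℤ) : ℝ) * l v) * (((ε w : ℤ) : ℝ) * l w) := by
        nth_rewrite 1 [← Equiv.sum_comp (flipSign v)]
        rw [← Finset.sum_neg_distrib]
        refine Finset.sum_congr rfl fun ε _ => ?_
        rw [flipSign_apply, Function.update_self, Function.update_of_ne (Ne.symm hvw)]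
        push_cast
        ring
      linarith
  simp_rw [sq (∑ v, _), Finset.sum_mul_sum]
  rw [Finset.sum_comm]
  simp_rw [Finset.sum_comm (s := (Finset.univ : Finset (κ → ℤˣ))), h]
  simp [Finset.mul_sum]

/-- The Khintchine step for 1 × 1 matrices with `p = 1`; the factor 3 is `2 * p + 1`. -/
theorem sum_pow_four_sum_sign_mul_le (l : κ → ℝ) :
    ∑ ε : κ → ℤˣ, (∑ v, ((ε v : ℤ) : ℝ) * l v) ^ 4 ≤
      3 * 2 ^ Fintype.card κ * (∑ v, l v ^ 2) ^ 2 := by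
  let L : κ → Matrix Unit Unit ℝ := fun v => Matrix.of fun _ _ => l v
  have hL : ∀ v, (L v).IsHermitian := fun v => by ext; simp [L]
  have hY : ∀ ε : κ → ℤˣ, ∀ k : ℕ,
      (signSum L ε ^ k).trace = (∑ v, ((ε v : ℤ) : ℝ) * l v) ^ k := by
    intro ε k
    have h1 : signSum L ε = Matrix.diagonal fun _ => ∑ v, ((ε v : ℤ) : ℝ) * l v := by
      ext i j
      simp [signSum, L, Matrix.sum_apply]
    rw [h1, Matrix.diagonal_pow]
    simp
  have h := sum_trace_signSum_pow_succ_le hL (s := ∑ v, l v ^ 2) (fun x => by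
    simp [L, dotProduct, Matrix.mulVec, Matrix.sum_apply, Matrix.mul_apply]
    apply le_of_eq
    simp only [sq]
    ring) 1
  simp only [hY] at h
  norm_num at h
  rw [sum_sq_sum_sign_mul] at h
  refine h.trans (le_of_eq ?_)
  ring

/-- By Cauchy–Schwarz and the fourth moment, a set of at most 1/12 of the signs carries at most half
of the second moment, since `3 / 12 = (1 / 2) ^ 2`. -/
theorem half_mul_le_sum_sq_sum_sign_mul (l : κ → ℝ) {good : Finset (κ → ℤˣ)}
    (hgood : 12 * (goodᶜ.card : ℝ) ≤ 2 ^ Fintype.card κ) :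
    2 ^ Fintype.card κ * (∑ v, l v ^ 2) / 2 ≤
      ∑ ε ∈ good, (∑ v, ((ε v : ℤ) : ℝ) * l v) ^ 2 := by
  set b : (κ → ℤˣ) → ℝ := fun ε => ∑ v, ((ε v : ℤ) : ℝ) * l v with hb
  have hs : 0 ≤ ∑ v, l v ^ 2 := Finset.sum_nonneg fun v _ => sq_nonneg _
  have h1 : (∑ ε ∈ goodᶜ, b ε ^ 2) ^ 2 ≤ (2 ^ Fintype.card κ * (∑ v, l v ^ 2) / 2) ^ 2 := by
    refine sq_sum_le_card_mul_sum_sq.trans ?_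
    have h2 : ∑ ε ∈ goodᶜ, (b ε ^ 2) ^ 2 ≤ 3 * 2 ^ Fintype.card κ * (∑ v, l v ^ 2) ^ 2 := by
      refine le_trans ?_ (sum_pow_four_sum_sign_mul_le l)
      simp only [← pow_mul]
      exact Finset.sum_le_sum_of_subset_of_nonneg (Finset.subset_univ _) fun ε _ _ =>
        (by decide : Even 4).pow_nonneg _
    have h3 := mul_le_mul (a := (goodᶜ.card : ℝ)) (b := 2 ^ Fintype.card κ / 12) (by linarith) h2
      (Finset.sum_nonneg fun ε _ => sq_nonneg _) (by positivity)
    refine h3.trans (le_of_eq ?_)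
    ring
  have h4 := abs_le_of_sq_le_sq h1 (by positivity)
  have h5 := Finset.sum_add_sum_compl good fun ε => b ε ^ 2
  rw [sum_sq_sum_sign_mul] at h5
  have h6 := (le_abs_self _).trans h4
  linarith

-- Every eigenvalue satisfies `l i ^ (2 * p) ≤ trace (Y ^ (2 * p))`, hence is at most `a`.
open Matrix in
theorem Matrix.IsHermitian.posSemidef_one_sub_inv_smul {Y : Matrix n n ℝ} (hY : Y.IsHermitian)
    {a : ℝ} (ha : 0 < a) {p : ℕ} (hp : p ≠ 0) (h : (Y ^ (2 * p)).trace ≤ a ^ (2 * p)) :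
    (1 - a⁻¹ • Y).PosSemidef := by
  obtain ⟨P, l, hP1, hP2, hP⟩ := hY.exists_orthogonal_diagonal
  have hl : ∀ i, l i ≤ a := by
    intro i
    rw [hP, Matrix.trace_mul_comm, ← Matrix.mul_assoc, hP1, Matrix.one_mul, trace_diagonal] at h
    have h1 : l i ^ (2 * p) ≤ a ^ (2 * p) :=
      (Finset.single_le_sum (f := fun i => l i ^ (2 * p))
        (fun j _ => (even_two_mul p).pow_nonneg _) (Finset.mem_univ i)).trans h
    exact (le_abs_self _).trans ((pow_le_pow_iff_left₀ (n := 2 * p) (abs_nonneg _) ha.le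
      (by omega)).1
      (by rwa [(even_two_mul p).pow_abs]))
  have e : 1 - a⁻¹ • Y = P * diagonal (fun i => 1 - a⁻¹ * l i) * Pᴴ := by
    have hY1 := hP 1
    simp only [pow_one] at hY1
    rw [hY1, ← hP2]
    have hd : diagonal (fun i => 1 - a⁻¹ * l i) = 1 - a⁻¹ • diagonal l := by
      ext i j
      by_cases hij : i = j <;> simp [hij]
    rw [hd, Matrix.mul_sub, Matrix.sub_mul]
    simp
  rw [e]
  refine PosSemidef.mul_mul_conjTranspose_same (PosSemidef.diagonal fun i => ?_) P
  have : a⁻¹ * l i ≤ a⁻¹ * a := mul_le_mul_of_nonneg_left (hl i) (by positivity)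
  rw [inv_mul_cancel₀ ha.ne'] at this
  simpa using this

end Khintchine

-- Schur test: bound `x i * x j` by `(x i ^ 2 + x j ^ 2) / 2` and use symmetry.
open Matrix in
theorem Matrix.dotProduct_mulVec_le_of_row_sum_le {n : Type*} [Fintype n] {V : Matrix n n ℝ} (h0 : ∀ i j, 0 ≤ V i j)
    (hV : V.IsHermitian) {s : ℝ} (hs : ∀ i, ∑ j, V i j ≤ s) (x : n → ℝ) :
    x ⬝ᵥ (V *ᵥ x) ≤ s * (x ⬝ᵥ x) := by
  have e : x ⬝ᵥ (V *ᵥ x) = ∑ i, ∑ j, V i j * (x i * x j) := by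
    simp only [dotProduct, mulVec, Finset.mul_sum]
    exact Finset.sum_congr rfl fun i _ => Finset.sum_congr rfl fun j _ => by ring
  have h1 : ∑ i, ∑ j, V i j * (x i * x j) ≤
      ∑ i, ∑ j, (V i j * (x i ^ 2 / 2) + V i j * (x j ^ 2 / 2)) := by
    refine Finset.sum_le_sum fun i _ => Finset.sum_le_sum fun j _ => ?_
    rw [← mul_add]
    exact mul_le_mul_of_nonneg_left (by nlinarith [sq_nonneg (x i - x j)]) (h0 i j)
  have h2 : ∑ i, ∑ j, V i j * (x j ^ 2 / 2) = ∑ i, ∑ j, V i j * (x i ^ 2 / 2) := by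
    rw [Finset.sum_comm]
    refine Finset.sum_congr rfl fun i _ => Finset.sum_congr rfl fun j _ => ?_
    rw [show V j i = V i j by simpa using congrFun₂ hV i j]
  have h3 : ∑ i, ∑ j, V i j * (x i ^ 2 / 2) ≤ s * (x ⬝ᵥ x) / 2 := by
    simp only [dotProduct, Finset.mul_sum, Finset.sum_div]
    refine Finset.sum_le_sum fun i _ => ?_
    rw [← Finset.sum_mul]
    nlinarith [hs i, sq_nonneg (x i)]
  simp only [Finset.sum_add_distrib, h2] at h1
  linarith

/-! ### Independence under product weights. -/

section ProductExpectation

variable {V α : Type*} [Fintype V] [DecidableEq V] [Fintype α]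

theorem sum_prod_weight_eq_one {w : V → α → ℝ} (hw : ∀ v, ∑ a, w v a = 1) :
    ∑ φ : V → α, ∏ v, w v (φ v) = 1 := by
  rw [← Fintype.piFinset_univ, ← Finset.prod_univ_sum]
  simp [hw]

theorem sum_prod_weight_mul_three {w : V → α → ℝ} (hw : ∀ v, ∑ a, w v a = 1) (f g h : α → ℝ)
    {a b c : V} (hab : a ≠ b) (hac : a ≠ c) (hbc : b ≠ c) :
    ∑ φ : V → α, (∏ v, w v (φ v)) * (f (φ a) * g (φ b) * h (φ c)) =
      (∑ x, w a x * f x) * (∑ x, w b x * g x) * (∑ x, w c x * h x) := by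
  have e : ∀ φ : V → α, (∏ v, w v (φ v)) * (f (φ a) * g (φ b) * h (φ c)) =
      ∏ v, w v (φ v) * ((if v = a then f (φ v) else 1) * (if v = b then g (φ v) else 1) *
        (if v = c then h (φ v) else 1)) := by
    intro φ
    rw [Finset.prod_mul_distrib, Finset.prod_mul_distrib, Finset.prod_mul_distrib,
      Finset.prod_ite_eq', Finset.prod_ite_eq', Finset.prod_ite_eq']
    simp
  simp_rw [e]
  rw [← Fintype.piFinset_univ,
    ← Finset.prod_univ_sum (t := fun _ => (Finset.univ : Finset α)) (f := fun v x => w v x *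
      ((if v = a then f x else 1) * (if v = b then g x else 1) * (if v = c then h x else 1)))]
  have e2 : ∀ v, ∑ x, w v x *
      ((if v = a then f x else 1) * (if v = b then g x else 1) * (if v = c then h x else 1)) =
      (if v = a then ∑ x, w v x * f x else 1) * (if v = b then ∑ x, w v x * g x else 1) *
        (if v = c then ∑ x, w v x * h x else 1) := by
    intro v
    by_cases h1 : v = a
    · subst h1; simp [hab, hac]
    · by_cases h2 : v = b
      · subst h2; simp [h1, hbc]
      · by_cases h3 : v = c
        · subst h3; simp [h1, h2]
        · simp [h1, h2, h3, hw]
  simp_rw [e2]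
  rw [Finset.prod_mul_distrib, Finset.prod_mul_distrib, Finset.prod_ite_eq',
    Finset.prod_ite_eq', Finset.prod_ite_eq']
  simp

end ProductExpectation

/-! ### Counting edges by ordered triples. -/

namespace MultiHypergraph

variable {V : Type*} [DecidableEq V]

/-- The multiplicity of the edge `{v, u, w}`. -/
def tripleMult (H : MultiHypergraph 3 V) (v u w : V) : ℕ := H.edges.count {v, u, w}

theorem tripleMult_swap_right (H : MultiHypergraph 3 V) (v u w : V) :
    H.tripleMult v u w = H.tripleMult v w u := by
  unfold tripleMult
  congr 1
  ext x
  simp only [Finset.mem_insert, Finset.mem_singleton]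
  tauto

theorem tripleMult_swap_left (H : MultiHypergraph 3 V) (v u w : V) :
    H.tripleMult v u w = H.tripleMult u v w := by
  unfold tripleMult
  congr 1
  ext x
  simp only [Finset.mem_insert, Finset.mem_singleton]
  tauto

/-- A repeated entry leaves a set of fewer than three elements. Sums may therefore run over all
ordered triples, while independence is needed only for distinct vertices. -/
theorem ne_of_tripleMult_ne_zero {H : MultiHypergraph 3 V} {v u w : V}
    (h : H.tripleMult v u w ≠ 0) : v ≠ u ∧ v ≠ w ∧ u ≠ w := by
  have hc := H.uniform _ (Multiset.count_pos.1 (Nat.pos_of_ne_zero h))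
  have h2 := fun a b : V => Finset.card_le_two (a := a) (b := b)
  refine ⟨?_, ?_, ?_⟩ <;> rintro rfl
  · rw [Finset.insert_eq_of_mem (by simp)] at hc
    exact absurd hc (by have := h2 v w; omega)
  · rw [Finset.insert_eq_of_mem (by simp)] at hc
    exact absurd hc (by have := h2 u v; omega)
  · rw [Finset.pair_eq_singleton] at hc
    exact absurd hc (by have := h2 v u; omega)

theorem tripleMult_induce (H : MultiHypergraph 3 V) (S : Finset V) (v u w : V) :
    (H.induce S).tripleMult v u w = if v ∈ S ∧ u ∈ S ∧ w ∈ S then H.tripleMult v u w else 0 := by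
  unfold tripleMult induce
  rw [Multiset.count_filter]
  simp [Finset.insert_subset_iff]

/-- Double counting: the weighted count has to be verified only for one edge at a time. -/
theorem _root_.Multiset.sum_mul_count_eq_mul_countP {α ι : Type*} [DecidableEq α] [Fintype ι]
    (s : Multiset α) (g : ι → α) (c : ι → ℕ) (k : ℕ) (P : α → Prop) [DecidablePred P]
    (h : ∀ e ∈ s, ∑ i, (if g i = e then c i else 0) = if P e then k else 0) :
    ∑ i, c i * s.count (g i) = k * s.countP P := by
  induction s using Multiset.induction with
  | empty => simp
  | cons a s ih =>
    have h1 := ih fun e he => h e (Multiset.mem_cons_of_mem he)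
    have h2 := h a (Multiset.mem_cons_self a s)
    simp only [Multiset.count_cons, Multiset.countP_cons, mul_add, Finset.sum_add_distrib, h1]
    simp only [mul_ite, mul_one, mul_zero, h2]

variable [Fintype V]

theorem sum_tripleMult_eq_codegree (H : MultiHypergraph 3 V) {v u : V} (hvu : v ≠ u) :
    ∑ w, H.tripleMult v u w = H.codegree v u := by
  have h := Multiset.sum_mul_count_eq_mul_countP H.edges (fun w : V => ({v, u, w} : Finset V))
    (fun _ => 1) 1 (fun e => v ∈ e ∧ u ∈ e) (fun e he => by
      split_ifs with hve
      · have hcard : (e \ {v, u}).card = 1 := by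
          rw [Finset.card_sdiff_of_subset (by simp [Finset.insert_subset_iff, hve]), H.uniform e he,
            Finset.card_pair hvu]
        obtain ⟨x, hx⟩ := Finset.card_eq_one.1 hcard
        have hmem : ∀ y, (y ∈ e ∧ y ≠ v ∧ y ≠ u) ↔ y = x := fun y => by
          have := Finset.ext_iff.1 hx y
          simpa using this
        rw [Finset.sum_eq_single x]
        · rw [if_pos]
          ext y
          have := hmem y
          simp only [Finset.mem_insert, Finset.mem_singleton]
          grind
        · intro w _ hw
          rw [if_neg]
          rintro rfl
          have h1 := (hmem w).not.2 hw
          have h2 := (hmem x).2 rfl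
          simp only [Finset.mem_insert, Finset.mem_singleton] at h2
          grind
        · simp
      · refine Finset.sum_eq_zero fun w _ => if_neg ?_
        rintro rfl
        exact hve (by simp))
  simpa [tripleMult, codegree] using h

theorem sum_sum_tripleMult_eq_two_mul_degree (H : MultiHypergraph 3 V) (v : V) :
    ∑ u, ∑ w, H.tripleMult v u w = 2 * H.degree v := by
  have h1 : ∀ u, ∑ w, H.tripleMult v u w = if v ≠ u then H.codegree v u else 0 := by
    intro u
    split_ifs with hvu
    · exact H.sum_tripleMult_eq_codegree hvu
    · refine Finset.sum_eq_zero fun w _ => ?_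
      by_contra h
      exact hvu (ne_of_tripleMult_ne_zero h).1
  have h2 : ∀ s : Multiset (Finset V), (∀ e ∈ s, e.card = 3) →
      ∑ u, (if v ≠ u then s.countP (fun e => v ∈ e ∧ u ∈ e) else 0) =
        2 * s.countP (fun e => v ∈ e) := by
    intro s
    induction s using Multiset.induction with
    | empty => simp
    | cons a s ih =>
      intro hs
      have h3 := ih fun e he => hs e (Multiset.mem_cons_of_mem he)
      have h4 : ∀ u, (if v ≠ u then (a ::ₘ s).countP (fun e => v ∈ e ∧ u ∈ e) else 0) =
          (if v ≠ u then s.countP (fun e => v ∈ e ∧ u ∈ e) else 0) +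
            if v ∈ a ∧ u ∈ a.erase v then 1 else 0 := by
        intro u
        rw [Multiset.countP_cons]
        by_cases hu : v = u <;> simp [hu, Finset.mem_erase, eq_comm]
      rw [Finset.sum_congr rfl fun u _ => h4 u, Finset.sum_add_distrib, h3, Multiset.countP_cons,
        mul_add]
      congr 1
      by_cases hv : v ∈ a
      · simp only [hv, true_and, if_true, Finset.sum_ite_mem, Finset.univ_inter]
        simp [Finset.card_erase_of_mem hv, hs a (Multiset.mem_cons_self a s)]
      · simp [hv]
  rw [Finset.sum_congr rfl fun u _ => h1 u]
  exact h2 H.edges H.uniform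

theorem sum_degree_eq_three_mul_numEdges (H : MultiHypergraph 3 V) :
    ∑ v, H.degree v = 3 * H.numEdges := by
  have h2 : ∀ s : Multiset (Finset V), (∀ e ∈ s, e.card = 3) →
      ∑ u, s.countP (fun e => u ∈ e) = 3 * Multiset.card s := by
    intro s
    induction s using Multiset.induction with
    | empty => simp
    | cons a s ih =>
      intro hs
      have h3 := ih fun e he => hs e (Multiset.mem_cons_of_mem he)
      simp only [Multiset.countP_cons, Finset.sum_add_distrib, h3, Multiset.card_cons, mul_add]
      simp [hs a (Multiset.mem_cons_self a s)]
  exact h2 H.edges H.uniform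

theorem sum_tripleMult_eq_six_mul_numEdges (H : MultiHypergraph 3 V) :
    ∑ v, ∑ u, ∑ w, H.tripleMult v u w = 6 * H.numEdges := by
  simp_rw [sum_sum_tripleMult_eq_two_mul_degree, ← Finset.mul_sum,
    sum_degree_eq_three_mul_numEdges]
  ring

theorem sum_tripleMult_cut (H : MultiHypergraph 3 V) (f : V → Fin 3) :
    ∑ v, ∑ u, ∑ w, (if f v = 2 then 1 else 0) * (if f u = 0 then 1 else 0) *
      (if f w = 1 then 1 else 0) * H.tripleMult v u w = H.cutSize f := by
  have h := Multiset.sum_mul_count_eq_mul_countP H.edges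
    (fun p : V × V × V => ({p.1, p.2.1, p.2.2} : Finset V))
    (fun p => (if f p.1 = 2 then 1 else 0) * (if f p.2.1 = 0 then 1 else 0) *
      (if f p.2.2 = 1 then 1 else 0)) 1 (fun e => ∀ i : Fin 3, ∃ v ∈ e, f v = i) (fun e he => by
      split_ifs with hrain
      · obtain ⟨v, hv, hfv⟩ := hrain 2
        obtain ⟨u, hu, hfu⟩ := hrain 0
        obtain ⟨w, hw, hfw⟩ := hrain 1
        have hvu : v ≠ u := by rintro rfl; simp [hfv] at hfu
        have hvw : v ≠ w := by rintro rfl; simp [hfv] at hfw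
        have huw : u ≠ w := by rintro rfl; simp [hfu] at hfw
        have hE : ({v, u, w} : Finset V) = e := Finset.eq_of_subset_of_card_le
          (by simp [Finset.insert_subset_iff, hv, hu, hw])
          (by rw [H.uniform e he, Finset.card_eq_three.2 ⟨v, u, w, hvu, hvw, huw, rfl⟩])
        rw [Finset.sum_eq_single (v, u, w)]
        · simp [hE, hfv, hfu, hfw]
        · rintro ⟨v', u', w'⟩ _ hne
          split_ifs with h1 h2 h3 h4 <;> try rfl
          exfalso
          dsimp only at h1 h2 h3 h4
          have hv' : v' ∈ ({v, u, w} : Finset V) := by rw [hE, ← h1]; simp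
          have hu' : u' ∈ ({v, u, w} : Finset V) := by rw [hE, ← h1]; simp
          have hw' : w' ∈ ({v, u, w} : Finset V) := by rw [hE, ← h1]; simp
          simp only [Finset.mem_insert, Finset.mem_singleton] at hv' hu' hw'
          apply hne
          have a1 : v' = v := by
            rcases hv' with rfl | rfl | rfl
            · rfl
            · simp [hfu] at h2
            · simp [hfw] at h2
          have a2 : u' = u := by
            rcases hu' with rfl | rfl | rfl
            · simp [hfv] at h3
            · rfl
            · simp [hfw] at h3
          have a3 : w' = w := by
            rcases hw' with rfl | rfl | rfl
            · simp [hfv] at h4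
            · simp [hfu] at h4
            · rfl
          rw [a1, a2, a3]
        · simp
      · refine Finset.sum_eq_zero fun p _ => ?_
        split_ifs with h1 h2 h3 h4 <;> try rfl
        exfalso
        apply hrain
        intro i
        fin_cases i
        · exact ⟨p.2.1, by rw [← h1]; simp, h3⟩
        · exact ⟨p.2.2, by rw [← h1]; simp, h4⟩
        · exact ⟨p.1, by rw [← h1]; simp, h2⟩)
  rw [one_mul, Fintype.sum_prod_type] at h
  simp_rw [Fintype.sum_prod_type] at h
  exact h

end MultiHypergraph

theorem two_mul_sq_mul_sq_le_mul_gaussianSignCorr {t : ℝ} (ht : |t| ≤ 1) :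
    2 * ProbabilityTheory.gaussianPDFReal 0 1 2 ^ 2 * t ^ 2 ≤ t * gaussianSignCorr t := by
  obtain ⟨h1, h2⟩ := abs_le.1 ht
  rcases le_total 0 t with h | h
  · have := two_mul_sq_mul_le_gaussianSignCorr h h2
    nlinarith
  · have := two_mul_sq_mul_le_gaussianSignCorr (t := -t) (by linarith) (by linarith)
    rw [gaussianSignCorr_neg] at this
    nlinarith

/-! ### Lower bounds for the maximum cut from random partitions. -/

namespace MultiHypergraph

variable {V : Type*} [DecidableEq V] [Fintype V]

theorem sum_tripleMult_mul_le_maxCut (H : MultiHypergraph 3 V) {p : V → Fin 3 → ℝ}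
    (hp0 : ∀ v i, 0 ≤ p v i) (hp1 : ∀ v, ∑ i, p v i = 1) :
    ∑ v, ∑ u, ∑ w, (H.tripleMult v u w : ℝ) * (p v 2 * p u 0 * p w 1) ≤ H.maxCut 3 := by
  have h1 : ∑ φ : V → Fin 3, (∏ v, p v (φ v)) * (H.cutSize φ : ℝ) ≤
      ∑ φ : V → Fin 3, (∏ v, p v (φ v)) * (H.maxCut 3 : ℝ) := by
    refine Finset.sum_le_sum fun φ _ => mul_le_mul_of_nonneg_left ?_
      (Finset.prod_nonneg fun v _ => hp0 v _)
    exact_mod_cast Finset.le_sup (f := fun f => H.cutSize f) (Finset.mem_univ φ)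
  rw [← Finset.sum_mul, sum_prod_weight_eq_one hp1, one_mul] at h1
  refine le_trans (le_of_eq ?_) h1
  have h2 : ∀ φ : V → Fin 3, (∏ v, p v (φ v)) * (H.cutSize φ : ℝ) =
      ∑ v, ∑ u, ∑ w, (∏ v, p v (φ v)) * ((if φ v = 2 then 1 else 0) *
        (if φ u = 0 then 1 else 0) * (if φ w = 1 then 1 else 0) * (H.tripleMult v u w : ℝ)) := by
    intro φ
    rw [← sum_tripleMult_cut]
    push_cast
    simp only [Finset.mul_sum]
  rw [Finset.sum_congr (g := fun φ => _) rfl fun φ _ => h2 φ]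
  symm
  rw [Finset.sum_comm]
  refine Finset.sum_congr rfl fun v _ => ?_
  rw [Finset.sum_comm]
  refine Finset.sum_congr rfl fun u _ => ?_
  rw [Finset.sum_comm]
  refine Finset.sum_congr rfl fun w _ => ?_
  by_cases hT : H.tripleMult v u w = 0
  · simp [hT]
  obtain ⟨h1, h2, h3⟩ := ne_of_tripleMult_ne_zero hT
  have := sum_prod_weight_mul_three hp1 (fun i => if i = 2 then (1 : ℝ) else 0)
    (fun i => if i = 0 then 1 else 0) (fun i => if i = 1 then 1 else 0) h1 h2 h3
  simp only [mul_ite, mul_one, mul_zero, Finset.sum_ite_eq', Finset.mem_univ, if_true] at this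
  rw [← this, Finset.mul_sum]
  refine Finset.sum_congr rfl fun φ _ => ?_
  by_cases k1 : φ v = 2 <;> by_cases k2 : φ u = 0 <;> by_cases k3 : φ w = 1 <;>
    simp [k1, k2, k3, mul_comm]

/-- Here `t v` is the probability of the third part and `x v` the bias between the other two.
Exchanging `u` and `w` averages `(1 + x u) * (1 - x w)` to `1 - x u * x w`. -/
theorem sum_tripleMult_mul_one_sub_le_maxCut (H : MultiHypergraph 3 V) {t x : V → ℝ}
    (ht0 : ∀ v, 0 ≤ t v) (ht1 : ∀ v, t v ≤ 1) (hx : ∀ v, |x v| ≤ 1) :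
    ∑ v, ∑ u, ∑ w, (H.tripleMult v u w : ℝ) *
      (t v * (1 - t u) * (1 - t w) * (1 - x u * x w)) / 4 ≤ H.maxCut 3 := by
  have h := H.sum_tripleMult_mul_le_maxCut
    (p := fun v => ![(1 - t v) * (1 + x v) / 2, (1 - t v) * (1 - x v) / 2, t v])
    (fun v i => by
      obtain ⟨h1, h2⟩ := abs_le.1 (hx v)
      have := ht1 v
      fin_cases i
      · exact div_nonneg (mul_nonneg (by linarith) (by linarith)) (by norm_num)
      · exact div_nonneg (mul_nonneg (by linarith) (by linarith)) (by norm_num)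
      · exact ht0 v)
    (fun v => by simp only [Fin.sum_univ_three, Matrix.cons_val]; ring)
  simp only [Matrix.cons_val] at h
  have h2 : ∑ v, ∑ u, ∑ w, (H.tripleMult v u w : ℝ) *
      (t v * ((1 - t u) * (1 + x u) / 2) * ((1 - t w) * (1 - x w) / 2)) =
      ∑ v, ∑ u, ∑ w, (H.tripleMult v u w : ℝ) *
      (t v * ((1 - t w) * (1 + x w) / 2) * ((1 - t u) * (1 - x u) / 2)) := by
    refine Finset.sum_congr rfl fun v _ => ?_
    rw [Finset.sum_comm]
    refine Finset.sum_congr rfl fun u _ => Finset.sum_congr rfl fun w _ => ?_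
    rw [tripleMult_swap_right]
  refine le_trans (le_of_eq ?_) h
  have h3 := congrArg₂ (· + ·) (Eq.refl (∑ v, ∑ u, ∑ w, (H.tripleMult v u w : ℝ) *
      (t v * ((1 - t u) * (1 + x u) / 2) * ((1 - t w) * (1 - x w) / 2)))) h2
  simp only [← two_mul] at h3
  have h4 : ∀ {a b : ℝ}, 2 * a = 2 * b → a = b := fun h => by linarith
  apply h4
  rw [h3, Finset.mul_sum, ← Finset.sum_add_distrib]
  refine Finset.sum_congr rfl fun v _ => ?_
  rw [Finset.mul_sum, ← Finset.sum_add_distrib]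
  refine Finset.sum_congr rfl fun u _ => ?_
  rw [Finset.mul_sum, ← Finset.sum_add_distrib]
  refine Finset.sum_congr rfl fun w _ => ?_
  ring

open MeasureTheory ProbabilityTheory in
theorem sum_sub_sum_gaussianSignCorr_le_maxCut (H : MultiHypergraph 3 V) {t n : V → ℝ}
    (ht0 : ∀ v, 0 ≤ t v) (ht1 : ∀ v, t v ≤ 1) (hn : ∀ v, |n v| ≤ 1) {X : Matrix V V ℝ}
    (hX : X.PosSemidef) (hd : ∀ i, X i i = 1) :
    ∑ v, ∑ u, ∑ w, (H.tripleMult v u w : ℝ) * (t v * (1 - t u) * (1 - t w)) / 4 -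
      ∑ v, ∑ u, ∑ w, (H.tripleMult v u w : ℝ) *
        (t v * (1 - t u) * (1 - t w) * (n u * n w * gaussianSignCorr (X u w))) / 4 ≤
      H.maxCut 3 := by
  set P := multivariateGaussian 0 X
  have hint : ∀ u w, Integrable
      (fun z : EuclideanSpace ℝ V => Real.sign (z u) * Real.sign (z w)) P := by
    intro u w
    refine Integrable.of_bound (C := 1) (((Real.measurable_sign.comp (by fun_prop)).mul
      (Real.measurable_sign.comp (by fun_prop))).aestronglyMeasurable)
      (Filter.Eventually.of_forall fun z => ?_)
    rw [Real.norm_eq_abs, abs_mul]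
    exact mul_le_one₀ (Real.abs_sign_le_one _) (abs_nonneg _) (Real.abs_sign_le_one _)
  have hint3 : ∀ v u w, Integrable (fun z : EuclideanSpace ℝ V => (H.tripleMult v u w : ℝ) *
      (t v * (1 - t u) * (1 - t w) * (n u * n w * (Real.sign (z u) * Real.sign (z w)))) / 4) P :=
    fun v u w => ((((hint u w).const_mul _).const_mul _).const_mul _).div_const _
  have hpt : ∀ z : EuclideanSpace ℝ V,
      ∑ v, ∑ u, ∑ w, (H.tripleMult v u w : ℝ) * (t v * (1 - t u) * (1 - t w)) / 4 -
      ∑ v, ∑ u, ∑ w, (H.tripleMult v u w : ℝ) *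
        (t v * (1 - t u) * (1 - t w) * (n u * n w * (Real.sign (z u) * Real.sign (z w)))) / 4 ≤
      H.maxCut 3 := by
    intro z
    refine le_trans (le_of_eq ?_) (H.sum_tripleMult_mul_one_sub_le_maxCut ht0 ht1
      (x := fun v => n v * Real.sign (z v)) fun v => ?_)
    · simp only [← Finset.sum_sub_distrib]
      refine Finset.sum_congr rfl fun v _ => Finset.sum_congr rfl fun u _ =>
        Finset.sum_congr rfl fun w _ => ?_
      ring
    · rw [abs_mul]
      exact mul_le_one₀ (hn v) (abs_nonneg _) (Real.abs_sign_le_one _)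
  have hI := integral_mono (μ := P) (((integrable_const _).sub (integrable_finsetSum _ fun v _ =>
    integrable_finsetSum _ fun u _ => integrable_finsetSum _ fun w _ => hint3 v u w)))
    (integrable_const _) hpt
  rw [integral_const, probReal_univ, one_smul] at hI
  refine le_trans (le_of_eq ?_) hI
  simp only [Pi.sub_apply]
  rw [integral_sub (integrable_const _) (integrable_finsetSum _ fun v _ =>
    integrable_finsetSum _ fun u _ => integrable_finsetSum _ fun w _ => hint3 v u w),
    integral_const, probReal_univ, one_smul]
  congr 1
  rw [integral_finsetSum _ fun v _ => integrable_finsetSum _ fun u _ =>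
    integrable_finsetSum _ fun w _ => hint3 v u w]
  refine Finset.sum_congr rfl fun v _ => ?_
  rw [integral_finsetSum _ fun u _ => integrable_finsetSum _ fun w _ => hint3 v u w]
  refine Finset.sum_congr rfl fun u _ => ?_
  rw [integral_finsetSum _ fun w _ => hint3 v u w]
  refine Finset.sum_congr rfl fun w _ => ?_
  rw [integral_div, integral_const_mul, integral_const_mul, integral_const_mul,
    integral_sign_mul_sign_multivariateGaussian hX hd]

end MultiHypergraph

/-! ### Rounding correlated with the signed sum of links. -/

namespace MultiHypergraph

variable {V : Type*} [DecidableEq V]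

/-- The link of `v`, restricted by the weight `b` of `v` and the weights `n` of the other two
vertices of an edge. -/
def weightedLink (H : MultiHypergraph 3 V) (b n : V → ℝ) (v : V) : Matrix V V ℝ :=
  Matrix.of fun u w => b v * (n u * n w) * (H.tripleMult v u w : ℝ)

theorem weightedLink_isHermitian (H : MultiHypergraph 3 V) (b n : V → ℝ) (v : V) :
    (H.weightedLink b n v).IsHermitian := by
  ext u w
  simp [weightedLink, H.tripleMult_swap_right v u w, mul_comm (n u)]

theorem weightedLink_apply_self (H : MultiHypergraph 3 V) (b n : V → ℝ) (v u : V) :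
    H.weightedLink b n v u u = 0 := by
  have : H.tripleMult v u u = 0 := by
    by_contra h
    exact (ne_of_tripleMult_ne_zero h).2.2 rfl
  simp [weightedLink, this]

variable [Fintype V]

theorem signSum_weightedLink_apply (H : MultiHypergraph 3 V) (b n : V → ℝ) (ε : V → ℤˣ)
    (u w : V) : signSum (H.weightedLink b n) ε u w =
      ∑ v, ((ε v : ℤ) : ℝ) * H.weightedLink b n v u w := by
  simp [signSum, Matrix.sum_apply]

/-- The summand is multilinear in the signs of three distinct vertices, so averaging replaces each
sign by 0. -/
theorem sum_signs_sum_tripleMult_mul (H : MultiHypergraph 3 V) (a b : V → ℝ) :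
    ∑ ε : V → ℤˣ, ∑ v, ∑ u, ∑ w, (H.tripleMult v u w : ℝ) *
      ((a v + b v / 2 * ((ε v : ℤ) : ℝ)) * (1 - (a u + b u / 2 * ((ε u : ℤ) : ℝ))) *
        (1 - (a w + b w / 2 * ((ε w : ℤ) : ℝ)))) / 4 =
      2 ^ Fintype.card V *
        ∑ v, ∑ u, ∑ w, (H.tripleMult v u w : ℝ) * (a v * (1 - a u) * (1 - a w)) / 4 := by
  simp only [Finset.mul_sum]
  rw [Finset.sum_comm]
  refine Finset.sum_congr rfl fun v _ => ?_
  rw [Finset.sum_comm]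
  refine Finset.sum_congr rfl fun u _ => ?_
  rw [Finset.sum_comm]
  refine Finset.sum_congr rfl fun w _ => ?_
  by_cases hT : H.tripleMult v u w = 0
  · simp [hT]
  obtain ⟨h1, h2, h3⟩ := ne_of_tripleMult_ne_zero hT
  have huniv : (Finset.univ : Finset ℤˣ) = {1, -1} := rfl
  have hsum : ∀ f : ℤˣ → ℝ, ∑ x, f x = f 1 + f (-1) := fun f => by
    rw [huniv, Finset.sum_pair (by decide)]
  have key := sum_prod_weight_mul_three (V := V) (α := ℤˣ) (w := fun _ _ => 1 / 2)
    (fun _ => by rw [hsum]; norm_num)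
    (fun x => a v + b v / 2 * ((x : ℤ) : ℝ)) (fun x => 1 - (a u + b u / 2 * ((x : ℤ) : ℝ)))
    (fun x => 1 - (a w + b w / 2 * ((x : ℤ) : ℝ))) h1 h2 h3
  simp only [hsum] at key
  simp only [Finset.prod_const, ← Finset.mul_sum, Finset.card_univ] at key
  rw [← Finset.sum_div, ← Finset.mul_sum]
  have key2 : ∀ X : ℝ, (1 / 2) ^ Fintype.card V * X = a v * (1 - a u) * (1 - a w) →
      X = 2 ^ Fintype.card V * (a v * (1 - a u) * (1 - a w)) := by
    intro X hX
    rw [← hX, ← mul_assoc, ← mul_pow]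
    norm_num
  rw [key2 _ (key.trans (by push_cast; ring))]
  ring

open ProbabilityTheory in
theorem add_sum_sq_weightedLink_le_maxCut (H : MultiHypergraph 3 V) {a b n : V → ℝ} {l : ℝ}
    (hl : 0 < l) (h0 : ∀ v, 0 ≤ a v - b v / 2) (h1 : ∀ v, a v + b v / 2 ≤ 1) (hb : ∀ v, 0 ≤ b v)
    (hn : ∀ v, n v = 0 ∨ n v = 1 ∧ a v = 0 ∧ b v = 0) {p : ℕ} (hp : p ≠ 0)
    (hmom : 12 * ∑ ε : V → ℤˣ, (signSum (H.weightedLink b n) ε ^ (2 * p)).trace ≤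
      2 ^ Fintype.card V * l ^ (2 * p)) :
    ∑ v, ∑ u, ∑ w, (H.tripleMult v u w : ℝ) * (a v * (1 - a u) * (1 - a w)) / 4 +
      gaussianPDFReal 0 1 2 ^ 2 / (8 * l) * ∑ u, ∑ w, ∑ v, H.weightedLink b n v u w ^ 2 ≤
      H.maxCut 3 := by
  set L := H.weightedLink b n with hL
  set c := gaussianPDFReal 0 1 2 ^ 2
  have hLH : ∀ v, (L v).IsHermitian := H.weightedLink_isHermitian b n
  have hYH : ∀ ε, (signSum L ε).IsHermitian := signSum_isHermitian hLH
  let t : (V → ℤˣ) → V → ℝ := fun ε v => a v + b v / 2 * ((ε v : ℤ) : ℝ)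
  have ht : ∀ ε v, 0 ≤ t ε v ∧ t ε v ≤ 1 := by
    intro ε v
    have := h0 v
    have := h1 v
    have := hb v
    rcases Int.units_eq_one_or (ε v) with h | h <;> simp only [t, h] <;> push_cast <;>
      constructor <;> linarith
  have hn1 : ∀ v, |n v| ≤ 1 := by
    intro v
    rcases hn v with h | h <;> simp [h]
  let good : Finset (V → ℤˣ) :=
    Finset.univ.filter fun ε => (signSum L ε ^ (2 * p)).trace ≤ l ^ (2 * p)
  have hgood : 12 * (goodᶜ.card : ℝ) ≤ 2 ^ Fintype.card V := by
    have h2 : (goodᶜ.card : ℝ) * l ^ (2 * p) ≤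
        ∑ ε : V → ℤˣ, (signSum L ε ^ (2 * p)).trace := by
      rw [← nsmul_eq_mul]
      refine (Finset.card_nsmul_le_sum goodᶜ (fun ε => (signSum L ε ^ (2 * p)).trace) _
        fun ε hε => ?_).trans (Finset.sum_le_sum_of_subset_of_nonneg (Finset.subset_univ _)
          fun ε _ _ => (hYH ε).trace_pow_two_mul_nonneg p)
      simp only [good, Finset.mem_compl, Finset.mem_filter, Finset.mem_univ, true_and,
        not_le] at hε
      exact hε.le
    have h3 : 0 < l ^ (2 * p) := by positivity
    refine le_of_mul_le_mul_right ?_ h3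
    linarith
  let base : (V → ℤˣ) → ℝ := fun ε =>
    ∑ v, ∑ u, ∑ w, (H.tripleMult v u w : ℝ) * (t ε v * (1 - t ε u) * (1 - t ε w)) / 4
  let fixedPart : (V → ℤˣ) → ℝ := fun ε => ∑ u, ∑ w, ∑ v, (H.tripleMult v u w : ℝ) *
    (a v * (n u * n w)) * gaussianSignCorr (l⁻¹ * signSum L ε u w)
  let signPart : (V → ℤˣ) → ℝ := fun ε => ∑ u, ∑ w,
    signSum L ε u w * gaussianSignCorr (l⁻¹ * signSum L ε u w)
  have hX : ∀ ε ∈ good, (1 - l⁻¹ • signSum L ε).PosSemidef := fun ε hε =>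
    (hYH ε).posSemidef_one_sub_inv_smul hl hp (Finset.mem_filter.1 hε).2
  have hXd : ∀ ε i, (1 - l⁻¹ • signSum L ε) i i = 1 := by
    intro ε i
    simp [hL, signSum_weightedLink_apply, weightedLink_apply_self]
  have hstep : ∀ ε ∈ good, base ε + (fixedPart ε / 4 + signPart ε / 8) ≤ H.maxCut 3 := by
    intro ε hε
    refine le_trans (le_of_eq ?_) (H.sum_sub_sum_gaussianSignCorr_le_maxCut
      (fun v => (ht ε v).1) (fun v => (ht ε v).2) hn1 (hX ε hε) (hXd ε))
    rw [sub_eq_add_neg]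
    congr 1
    -- If `n u` and `n w` are nonzero then `t ε u = t ε w = 0`, so the term is affine in `ε v`: the
    -- constant `a v` goes to `fixedPart`, the half-sign to `signPart`.
    have hterm : ∀ v u w, -((H.tripleMult v u w : ℝ) * (t ε v * (1 - t ε u) * (1 - t ε w) *
        (n u * n w * gaussianSignCorr ((1 - l⁻¹ • signSum L ε) u w))) / 4) =
        (H.tripleMult v u w : ℝ) * (a v * (n u * n w)) *
          gaussianSignCorr (l⁻¹ * signSum L ε u w) / 4 +
        ((ε v : ℤ) : ℝ) * L v u w * gaussianSignCorr (l⁻¹ * signSum L ε u w) / 8 := by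
      intro v u w
      by_cases hT : H.tripleMult v u w = 0
      · simp [hL, weightedLink, hT]
      have huw := (ne_of_tripleMult_ne_zero hT).2.2
      have hF : gaussianSignCorr ((1 - l⁻¹ • signSum L ε) u w) =
          -gaussianSignCorr (l⁻¹ * signSum L ε u w) := by
        rw [← gaussianSignCorr_neg]
        simp [huw]
      rw [hF]
      rcases hn u with hu | ⟨hu, hau, hbu⟩
      · simp [hu, hL, weightedLink]
      rcases hn w with hw | ⟨hw, haw, hbw⟩
      · simp [hw, hL, weightedLink]
      simp only [t, hau, hbu, haw, hbw, hu, hw, hL, weightedLink, Matrix.of_apply]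
      ring
    simp only [fixedPart, signPart, Finset.sum_div, ← Finset.sum_neg_distrib, hterm]
    symm
    rw [Finset.sum_comm, ← Finset.sum_add_distrib]
    refine Finset.sum_congr rfl fun u _ => ?_
    rw [Finset.sum_comm, ← Finset.sum_add_distrib]
    refine Finset.sum_congr rfl fun w _ => ?_
    rw [Finset.sum_add_distrib]
    congr 1
    rw [hL, signSum_weightedLink_apply, Finset.sum_mul, Finset.sum_div]
  -- For the remaining signs, `n = 0` switches the correlation off and nothing is lost.
  have hbad : ∀ ε, base ε ≤ H.maxCut 3 := by
    intro ε
    simpa using H.sum_sub_sum_gaussianSignCorr_le_maxCut (n := 0)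
      (fun v => (ht ε v).1) (fun v => (ht ε v).2) (by simp) Matrix.PosSemidef.one (by simp)
  -- `good` is invariant under `ε ↦ -ε`, because the exponent is even, and `fixedPart` is odd.
  have hfixed : ∑ ε ∈ good, fixedPart ε = 0 := by
    have hneg : ∑ ε ∈ good, fixedPart ε = ∑ ε ∈ good, -fixedPart ε := by
      refine Finset.sum_equiv (Equiv.neg _) (fun ε => ?_) fun ε _ => ?_
      · simp [good, signSum_neg, (even_two_mul p).neg_pow]
      · simp only [fixedPart, Equiv.neg_apply, signSum_neg, Matrix.neg_apply, mul_neg,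
          gaussianSignCorr_neg, Finset.sum_neg_distrib, neg_neg]
    rw [Finset.sum_neg_distrib] at hneg
    linarith
  have hsign : c / l * 2 ^ Fintype.card V * ∑ u, ∑ w, ∑ v, L v u w ^ 2 ≤
      ∑ ε ∈ good, signPart ε := by
    have h2 : ∀ ε ∈ good, ∑ u, ∑ w, 2 * c / l * signSum L ε u w ^ 2 ≤ signPart ε := by
      intro ε hε
      refine Finset.sum_le_sum fun u _ => Finset.sum_le_sum fun w _ => ?_
      set y := signSum L ε u w with hy
      have hle : |l⁻¹ * y| ≤ 1 := by
        by_cases huw : u = w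
        · rw [hy, huw, hL, signSum_weightedLink_apply]
          simp [weightedLink_apply_self]
        · have := (hX ε hε).sq_apply_le_one (hXd ε) u w
          rw [← sq_le_one_iff_abs_le_one]
          simpa [huw, hy] using this
      have h3 := mul_le_mul_of_nonneg_left (two_mul_sq_mul_sq_le_mul_gaussianSignCorr hle) hl.le
      calc 2 * c / l * y ^ 2 = l * (2 * c * (l⁻¹ * y) ^ 2) := by field_simp
        _ ≤ l * (l⁻¹ * y * gaussianSignCorr (l⁻¹ * y)) := h3
        _ = y * gaussianSignCorr (l⁻¹ * y) := by field_simp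
    refine le_trans ?_ (Finset.sum_le_sum h2)
    rw [Finset.sum_comm (s := good), Finset.mul_sum]
    refine Finset.sum_le_sum fun u _ => ?_
    rw [Finset.sum_comm (s := good), Finset.mul_sum]
    refine Finset.sum_le_sum fun w _ => ?_
    rw [← Finset.mul_sum]
    have h4 := half_mul_le_sum_sq_sum_sign_mul (fun v => L v u w) hgood
    have h5 := mul_le_mul_of_nonneg_left h4 (show 0 ≤ 2 * c / l by positivity)
    simp only [hL, signSum_weightedLink_apply] at h5 ⊢
    refine le_trans (le_of_eq ?_) h5
    ring
  have htotal : ∑ ε, base ε + (∑ ε ∈ good, fixedPart ε / 4 + ∑ ε ∈ good, signPart ε / 8) ≤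
      2 ^ Fintype.card V * (H.maxCut 3 : ℝ) := by
    have h2 : ∀ ε ∈ Finset.univ, base ε +
        (if ε ∈ good then fixedPart ε / 4 + signPart ε / 8 else 0) ≤ (H.maxCut 3 : ℝ) := by
      intro ε _
      split_ifs with h
      · exact hstep ε h
      · simpa using hbad ε
    have h3 := Finset.sum_le_sum h2
    rw [Finset.sum_add_distrib, Finset.sum_ite_mem, Finset.univ_inter,
      Finset.sum_add_distrib] at h3
    refine h3.trans (le_of_eq ?_)
    simp
  have hbase := H.sum_signs_sum_tripleMult_mul a b
  change ∑ ε, base ε = _ at hbase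
  rw [hbase, ← Finset.sum_div, ← Finset.sum_div, hfixed] at htotal
  have hpos : (0 : ℝ) < 2 ^ Fintype.card V := by positivity
  refine le_of_mul_le_mul_left ?_ hpos
  refine le_trans ?_ htotal
  have e : c / (8 * l) = c / l / 8 := by rw [div_div, mul_comm]
  rw [mul_add, e]
  linarith

end MultiHypergraph

/-! ### Moment bound for the links and random choice of the candidates. -/

namespace MultiHypergraph

variable {V : Type*} [DecidableEq V] [Fintype V]

theorem sum_tripleMult_le_maxCodegree (H : MultiHypergraph 3 V) (v u : V) :
    ∑ w, H.tripleMult v u w ≤ H.maxCodegree := by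
  by_cases hvu : v = u
  · have : ∀ w, H.tripleMult v u w = 0 := fun w => by
      by_contra h
      exact (ne_of_tripleMult_ne_zero h).1 hvu
    simp [this]
  · rw [H.sum_tripleMult_eq_codegree hvu]
    exact Finset.le_sup (f := fun p : V × V => H.codegree p.1 p.2) (b := (v, u)) (by simp [hvu])

theorem tripleMult_le_maxCodegree (H : MultiHypergraph 3 V) (v u w : V) :
    H.tripleMult v u w ≤ H.maxCodegree :=
  (Finset.single_le_sum (f := fun w => H.tripleMult v u w) (fun _ _ => Nat.zero_le _)
    (Finset.mem_univ w)).trans (H.sum_tripleMult_le_maxCodegree v u)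

theorem sum_sum_tripleMult_le_two_mul_maxDegree (H : MultiHypergraph 3 V) (u : V) :
    ∑ v, ∑ w, H.tripleMult v u w ≤ 2 * H.maxDegree := by
  simp_rw [fun v w => H.tripleMult_swap_left v u w]
  rw [sum_sum_tripleMult_eq_two_mul_degree]
  exact Nat.mul_le_mul_left 2 (Finset.le_sup (f := fun v => H.degree v) (Finset.mem_univ u))

/-- Row sums of one link are co-degrees, at most `D`, and a row summed over all links is at most
`2Δ`. Hence the rows of `∑ L v * L v` sum to at most `2ΔD`, and the second moment is at most `6 *
numEdges * D`. -/
theorem sum_trace_signSum_pow_le_of_le_tripleMult (G : MultiHypergraph 3 V)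
    {L : V → Matrix V V ℝ} (hLH : ∀ v, (L v).IsHermitian) (h0 : ∀ v u w, 0 ≤ L v u w)
    (hle : ∀ v u w, L v u w ≤ G.tripleMult v u w) (p : ℕ) :
    ∑ ε : V → ℤˣ, (signSum L ε ^ (2 * (p + 1))).trace ≤
      (2 * (p + 1) * (2 * G.maxDegree * G.maxCodegree)) ^ p *
        (2 ^ Fintype.card V * (6 * G.numEdges * G.maxCodegree)) := by
  set D : ℝ := (G.maxCodegree : ℝ) with hD
  have hD0 : 0 ≤ D := by positivity
  have hrow : ∀ v u, ∑ w, L v u w ≤ D := fun v u =>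
    (Finset.sum_le_sum fun w _ => hle v u w).trans
      (by rw [hD]; exact_mod_cast G.sum_tripleMult_le_maxCodegree v u)
  have hdeg : ∀ u, ∑ v, ∑ w, L v u w ≤ 2 * G.maxDegree := fun u =>
    (Finset.sum_le_sum fun v _ => Finset.sum_le_sum fun w _ => hle v u w).trans
      (by exact_mod_cast G.sum_sum_tripleMult_le_two_mul_maxDegree u)
  have hquad := Matrix.dotProduct_mulVec_le_of_row_sum_le (V := ∑ v, L v * L v)
    (s := 2 * G.maxDegree * D)
    (fun i j => by
      simp only [Matrix.sum_apply, Matrix.mul_apply]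
      exact Finset.sum_nonneg fun v _ => Finset.sum_nonneg fun k _ => mul_nonneg (h0 _ _ _)
        (h0 _ _ _))
    (by
      unfold Matrix.IsHermitian
      rw [Matrix.conjTranspose_sum]
      refine Finset.sum_congr rfl fun v _ => ?_
      rw [Matrix.conjTranspose_mul, (hLH v).eq])
    (fun i => by
      simp only [Matrix.sum_apply, Matrix.mul_apply]
      calc ∑ j, ∑ v, ∑ k, L v i k * L v k j = ∑ v, ∑ k, L v i k * ∑ j, L v k j := by
            rw [Finset.sum_comm]
            refine Finset.sum_congr rfl fun v _ => ?_
            rw [Finset.sum_comm]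
            simp only [Finset.mul_sum]
        _ ≤ ∑ v, ∑ k, L v i k * D := Finset.sum_le_sum fun v _ => Finset.sum_le_sum fun k _ =>
            mul_le_mul_of_nonneg_left (hrow v k) (h0 v i k)
        _ = (∑ v, ∑ k, L v i k) * D := by simp only [Finset.sum_mul]
        _ ≤ 2 * G.maxDegree * D := mul_le_mul_of_nonneg_right (hdeg i) hD0)
  refine (sum_trace_signSum_pow_le hLH (by positivity) hquad p).trans ?_
  refine mul_le_mul_of_nonneg_left ?_ (by positivity)
  have htr : ∀ ε, (signSum L ε ^ 2).trace = ∑ u, ∑ w, (∑ v, ((ε v : ℤ) : ℝ) * L v u w) ^ 2 := by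
    intro ε
    have hY := signSum_isHermitian hLH ε
    rw [sq, Matrix.trace]
    refine Finset.sum_congr rfl fun u _ => ?_
    rw [Matrix.diag_apply, Matrix.mul_apply]
    refine Finset.sum_congr rfl fun w _ => ?_
    rw [show signSum L ε w u = signSum L ε u w by simpa using congrFun₂ hY u w, sq]
    simp [signSum, Matrix.sum_apply]
  have hsum : ∑ ε, (signSum L ε ^ 2).trace =
      2 ^ Fintype.card V * ∑ u, ∑ w, ∑ v, L v u w ^ 2 := by
    simp only [htr]
    rw [Finset.sum_comm, Finset.mul_sum]
    refine Finset.sum_congr rfl fun u _ => ?_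
    rw [Finset.sum_comm, Finset.mul_sum]
    exact Finset.sum_congr rfl fun w _ => sum_sq_sum_sign_mul _
  rw [hsum]
  refine mul_le_mul_of_nonneg_left ?_ (by positivity)
  have h6 : ∑ u, ∑ w, ∑ v, (G.tripleMult v u w : ℝ) = 6 * G.numEdges := by
    have := G.sum_tripleMult_eq_six_mul_numEdges
    rw [Finset.sum_comm] at this
    rw [Finset.sum_congr rfl fun u _ => Finset.sum_comm]
    exact_mod_cast this
  rw [← h6]
  simp only [Finset.sum_mul]
  refine Finset.sum_le_sum fun u _ => Finset.sum_le_sum fun w _ => Finset.sum_le_sum fun v _ => ?_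
  have h7 : L v u w ≤ D := (hle v u w).trans
    (by rw [hD]; exact_mod_cast G.tripleMult_le_maxCodegree v u w)
  rw [sq]
  exact mul_le_mul (hle v u w) h7 (h0 v u w) (by positivity)

open ProbabilityTheory in
theorem mul_div_le_surplus (H : MultiHypergraph 3 V) (S : Finset V) {l : ℝ} (hl : 0 < l) (k : ℕ)
    (hmom : 12 * ((2 * (k + 1) * (2 * (H.induce S).maxDegree * (H.induce S).maxCodegree)) ^ k *
      (6 * (H.induce S).numEdges * (H.induce S).maxCodegree)) ≤ l ^ (2 * (k + 1))) :
    gaussianPDFReal 0 1 2 ^ 2 / (18 * l) * (H.induce S).numEdges ≤ H.surplus 3 := by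
  set G := H.induce S with hG
  set κ : ℝ := gaussianPDFReal 0 1 2 ^ 2 / (8 * l) with hκ
  have hκ0 : 0 ≤ κ := by positivity
  -- `true` marks candidates. Outside `S`, `b = n = 0`, so those vertices contribute only to the
  -- base term.
  let a : V → Bool → ℝ := fun v x => if v ∈ S then (if x then 1 / 2 else 0) else 1 / 3
  let b : V → Bool → ℝ := fun v x => if v ∈ S then (if x then 1 else 0) else 0
  let n : V → Bool → ℝ := fun v x => if v ∈ S then (if x then 0 else 1) else 0
  have hvals : ∀ v x, (b v x = 0 ∨ b v x = 1) ∧ (n v x = 0 ∨ n v x = 1) ∧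
      (b v x ≠ 0 → v ∈ S) ∧ (n v x ≠ 0 → v ∈ S) := by
    intro v x
    by_cases hv : v ∈ S <;> cases x <;> simp [b, n, hv]
  have hlink : ∀ (q : V → Bool) v u w,
      H.weightedLink (fun v => b v (q v)) (fun v => n v (q v)) v u w =
        b v (q v) * (n u (q u) * n w (q w)) * (G.tripleMult v u w : ℝ) := by
    intro q v u w
    rw [weightedLink, Matrix.of_apply, hG, tripleMult_induce]
    split_ifs with hS
    · rfl
    · have : b v (q v) * (n u (q u) * n w (q w)) = 0 := by
        by_contra hne
        simp only [mul_eq_zero, not_or] at hne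
        exact hS ⟨(hvals v _).2.2.1 hne.1, (hvals u _).2.2.2 hne.2.1, (hvals w _).2.2.2 hne.2.2⟩
      simp [this]
  have hone : ∀ q : V → Bool,
      ∑ v, ∑ u, ∑ w, (H.tripleMult v u w : ℝ) *
        (a v (q v) * (1 - a u (q u)) * (1 - a w (q w))) / 4 +
      κ * ∑ v, ∑ u, ∑ w, (G.tripleMult v u w : ℝ) * (b v (q v) * n u (q u) * n w (q w)) ≤
        H.maxCut 3 := by
    intro q
    have hmom' := G.sum_trace_signSum_pow_le_of_le_tripleMult
      (H.weightedLink_isHermitian (fun v => b v (q v)) (fun v => n v (q v)))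
      (fun v u w => by
        rw [hlink]
        rcases (hvals v (q v)).1 with h1 | h1 <;> rcases (hvals u (q u)).2.1 with h2 | h2 <;>
          rcases (hvals w (q w)).2.1 with h3 | h3 <;> simp [h1, h2, h3])
      (fun v u w => by
        rw [hlink]
        rcases (hvals v (q v)).1 with h1 | h1 <;> rcases (hvals u (q u)).2.1 with h2 | h2 <;>
          rcases (hvals w (q w)).2.1 with h3 | h3 <;> simp [h1, h2, h3]) k
    have h := H.add_sum_sq_weightedLink_le_maxCut (a := fun v => a v (q v))
      (b := fun v => b v (q v)) (n := fun v => n v (q v)) hl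
      (fun v => by by_cases hv : v ∈ S <;> cases q v <;> simp [a, b, hv])
      (fun v => by by_cases hv : v ∈ S <;> cases q v <;> norm_num [a, b, hv])
      (fun v => by by_cases hv : v ∈ S <;> cases q v <;> simp [b, hv])
      (fun v => by by_cases hv : v ∈ S <;> cases q v <;> simp [a, b, n, hv])
      (Nat.succ_ne_zero k) (by
        refine (mul_le_mul_of_nonneg_left hmom' (by norm_num)).trans ?_
        have := mul_le_mul_of_nonneg_left hmom
          (show (0 : ℝ) ≤ 2 ^ Fintype.card V by positivity)
        refine le_trans (le_of_eq ?_) this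
        ring)
    refine le_trans (add_le_add le_rfl (mul_le_mul_of_nonneg_left ?_ hκ0)) h
    rw [Finset.sum_comm]
    refine Finset.sum_le_sum fun u _ => ?_
    rw [Finset.sum_comm]
    refine Finset.sum_le_sum fun w _ => Finset.sum_le_sum fun v _ => ?_
    rw [hlink]
    -- Multiplicities are natural numbers, so the sum of squares dominates the number of edges.
    have hT : (G.tripleMult v u w : ℝ) ≤ (G.tripleMult v u w : ℝ) ^ 2 := by
      exact_mod_cast Nat.le_self_pow two_ne_zero _
    rcases (hvals v (q v)).1 with h1 | h1 <;> rcases (hvals u (q u)).2.1 with h2 | h2 <;>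
      rcases (hvals w (q w)).2.1 with h3 | h3 <;> simp [h1, h2, h3, hT]
  -- The weight 2/3 gives `a` mean 1/3 on `S` too, so the base term is exactly `2 / 9 * numEdges`.
  let wt : Bool → ℝ := fun x => if x then 2 / 3 else 1 / 3
  have hwt : ∀ _ : V, ∑ x, wt x = 1 := fun _ => by simp [wt]; norm_num
  have havg := Finset.sum_le_sum fun (q : V → Bool) (_ : q ∈ Finset.univ) =>
    mul_le_mul_of_nonneg_left (hone q) (show 0 ≤ ∏ v, wt (q v) from
      Finset.prod_nonneg fun v _ => by cases hq : q v <;> norm_num [wt])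
  rw [← Finset.sum_mul, sum_prod_weight_eq_one (w := fun _ => wt) hwt, one_mul] at havg
  simp only [mul_add, Finset.sum_add_distrib] at havg
  have e1 : ∑ q : V → Bool, (∏ v, wt (q v)) * ∑ v, ∑ u, ∑ w, (H.tripleMult v u w : ℝ) *
      (a v (q v) * (1 - a u (q u)) * (1 - a w (q w))) / 4 =
      ∑ v, ∑ u, ∑ w, (H.tripleMult v u w : ℝ) * (1 / 27) := by
    simp only [Finset.mul_sum]
    rw [Finset.sum_comm]
    refine Finset.sum_congr rfl fun v _ => ?_
    rw [Finset.sum_comm]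
    refine Finset.sum_congr rfl fun u _ => ?_
    rw [Finset.sum_comm]
    refine Finset.sum_congr rfl fun w _ => ?_
    by_cases hT : H.tripleMult v u w = 0
    · simp [hT]
    obtain ⟨h1, h2, h3⟩ := ne_of_tripleMult_ne_zero hT
    have key := sum_prod_weight_mul_three (w := fun _ => wt) hwt (a v)
      (fun x => 1 - a u x) (fun x => 1 - a w x) h1 h2 h3
    have k1 : ∀ v, ∑ x, wt x * a v x = 1 / 3 := fun v => by
      by_cases hv : v ∈ S <;> simp [wt, a, hv] <;> norm_num
    have k2 : ∀ v, ∑ x, wt x * (1 - a v x) = 2 / 3 := fun v => by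
      by_cases hv : v ∈ S <;> simp [wt, a, hv] <;> norm_num
    rw [k1, k2, k2] at key
    have : ∀ q : V → Bool, (∏ v, wt (q v)) * ((H.tripleMult v u w : ℝ) *
        (a v (q v) * (1 - a u (q u)) * (1 - a w (q w))) / 4) = (H.tripleMult v u w : ℝ) / 4 *
        ((∏ v, wt (q v)) * (a v (q v) * (1 - a u (q u)) * (1 - a w (q w)))) := fun q => by ring
    simp only [this]
    rw [← Finset.mul_sum, key]
    ring
  have e2 : ∑ q : V → Bool, (∏ v, wt (q v)) * (κ * ∑ v, ∑ u, ∑ w, (G.tripleMult v u w : ℝ) *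
      (b v (q v) * n u (q u) * n w (q w))) =
      κ * ∑ v, ∑ u, ∑ w, (G.tripleMult v u w : ℝ) * (2 / 27) := by
    simp only [Finset.mul_sum]
    rw [Finset.sum_comm]
    refine Finset.sum_congr rfl fun v _ => ?_
    rw [Finset.sum_comm]
    refine Finset.sum_congr rfl fun u _ => ?_
    rw [Finset.sum_comm]
    refine Finset.sum_congr rfl fun w _ => ?_
    by_cases hT : G.tripleMult v u w = 0
    · simp [hT]
    obtain ⟨h1, h2, h3⟩ := ne_of_tripleMult_ne_zero hT
    have hS : v ∈ S ∧ u ∈ S ∧ w ∈ S := by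
      by_contra hS
      rw [hG, tripleMult_induce, if_neg hS] at hT
      exact hT rfl
    obtain ⟨hv, hu, hw⟩ := hS
    have key := sum_prod_weight_mul_three (w := fun _ => wt) hwt (b v) (n u) (n w) h1 h2 h3
    have k1 : ∑ x, wt x * b v x = 2 / 3 := by simp [wt, b, hv]
    have k2 : ∀ v ∈ S, ∑ x, wt x * n v x = 1 / 3 := fun v hv => by simp [wt, n, hv]
    rw [k1, k2 u hu, k2 w hw] at key
    have : ∀ q : V → Bool, (∏ v, wt (q v)) * (κ * ((G.tripleMult v u w : ℝ) *
        (b v (q v) * n u (q u) * n w (q w)))) = κ * (G.tripleMult v u w : ℝ) *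
        ((∏ v, wt (q v)) * (b v (q v) * n u (q u) * n w (q w))) := fun q => by ring
    simp only [this]
    rw [← Finset.mul_sum, key]
    ring
  have cast6 : ∀ (F : MultiHypergraph 3 V) (r : ℝ),
      ∑ v, ∑ u, ∑ w, (F.tripleMult v u w : ℝ) * r = 6 * F.numEdges * r := by
    intro F r
    have h6 := F.sum_tripleMult_eq_six_mul_numEdges
    have h7 : ∑ v, ∑ u, ∑ w, (F.tripleMult v u w : ℝ) = 6 * F.numEdges := by exact_mod_cast h6
    rw [← h7]
    simp only [Finset.sum_mul]
  rw [e1, e2, cast6, cast6] at havg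
  have hsurp : H.surplus 3 = (H.maxCut 3 : ℝ) - 2 / 9 * H.numEdges := by
    have h33 : Nat.stirlingSecond 3 3 = 1 := Nat.stirlingSecond_self 3
    rw [surplus, h33]
    norm_num [Nat.factorial]
  have e3 : gaussianPDFReal 0 1 2 ^ 2 / (18 * l) = κ * (4 / 9) := by
    rw [hκ]
    field_simp
    ring
  rw [hsurp, e3]
  linarith

end MultiHypergraph

/-! ### Choice of the moment order and of the constants. -/

theorem Real.log_add_one_le_mul_log_pow_four {x : ℝ} (hx : 2 ≤ x) :
    864 * (Real.log x + 1) ≤ 6561 * Real.log x ^ 4 := by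
  have h2 : 0.69 ≤ Real.log x := by
    have := Real.log_two_gt_d9
    have := Real.log_le_log (by norm_num) hx
    linarith
  set y := Real.log x
  have h3 : 0.69 ^ 3 ≤ y ^ 3 := pow_le_pow_left₀ (by norm_num) h2 3
  nlinarith [mul_nonneg (sub_nonneg.2 h3) (by linarith : (0 : ℝ) ≤ y)]

open ProbabilityTheory in
theorem theorem1p3 :
    ∃ c : ℝ, 0 < c ∧
      ∀ (V : Type*) [Fintype V] [DecidableEq V] (H : MultiHypergraph 3 V) (S : Finset V)
        (m Δ D : ℕ),
        2 ≤ m →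
        (H.induce S).numEdges = m →
        (H.induce S).maxDegree = Δ →
        (H.induce S).maxCodegree = D →
        c * ((m : ℝ) / (Real.sqrt ((Δ : ℝ) * (D : ℝ)) * (Real.log (m : ℝ)) ^ 2)) ≤
          H.surplus 3 := by
  have hpdf : 0 < gaussianPDFReal 0 1 2 := gaussianPDFReal_pos 0 1 2 one_ne_zero
  -- `1458 = 18 * 81`: 18 is from `mul_div_le_surplus`, 81 from the bound on `l` below.
  refine ⟨gaussianPDFReal 0 1 2 ^ 2 / 1458, by positivity, ?_⟩
  intro V _ _ H S m Δ D hm hnum hΔ hD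
  have hmR : (2 : ℝ) ≤ m := by exact_mod_cast hm
  have hlog : 0 < Real.log m := Real.log_pos (by linarith)
  obtain ⟨v, u, w, hT⟩ : ∃ v u w, (H.induce S).tripleMult v u w ≠ 0 := by
    by_contra! hall
    have := (H.induce S).sum_tripleMult_eq_six_mul_numEdges
    simp only [hall, Finset.sum_const_zero] at this
    omega
  have hD1 : 1 ≤ D := by
    have := (H.induce S).tripleMult_le_maxCodegree v u w
    omega
  have hΔ1 : 1 ≤ Δ := by
    have h1 := (H.induce S).sum_sum_tripleMult_le_two_mul_maxDegree u
    have h2 : (H.induce S).tripleMult v u w ≤ ∑ v, ∑ w, (H.induce S).tripleMult v u w :=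
      (Finset.single_le_sum (f := fun w => (H.induce S).tripleMult v u w)
        (fun _ _ => Nat.zero_le _) (Finset.mem_univ w)).trans
      (Finset.single_le_sum (f := fun v => ∑ w, (H.induce S).tripleMult v u w)
        (fun _ _ => Nat.zero_le _) (Finset.mem_univ v))
    omega
  have hDR : (1 : ℝ) ≤ D := by exact_mod_cast hD1
  have hΔR : (1 : ℝ) ≤ Δ := by exact_mod_cast hΔ1
  obtain ⟨k, hk⟩ : ∃ k : ℕ, ⌈Real.log m⌉₊ = k + 1 :=
    Nat.exists_eq_succ_of_ne_zero (Nat.ceil_pos.2 hlog).ne'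
  have hk1 : Real.log m ≤ k + 1 := by
    have := Nat.le_ceil (Real.log m)
    rw [hk] at this
    exact_mod_cast this
  have hk2 : (k : ℝ) + 1 ≤ Real.log m + 1 := by
    have := (Nat.ceil_lt_add_one hlog.le).le
    rw [hk] at this
    exact_mod_cast this
  -- `864 = 4 * 72 * 3`: 4 from the Khintchine base, `72 = 12 * 6` from the prefactors, and 3 from
  -- `m ≤ 3 ^ (k + 1)`.
  set l : ℝ := √(864 * (k + 1) * (Δ * D)) with hl
  have hl0 : 0 < l := Real.sqrt_pos.2 (by positivity)
  have hmexp : (m : ℝ) ≤ 3 ^ (k + 1) := by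
    calc (m : ℝ) = Real.exp (Real.log m) := (Real.exp_log (by linarith)).symm
      _ ≤ Real.exp ((k + 1 : ℕ) * 1) := Real.exp_le_exp.2 (by push_cast; linarith)
      _ = Real.exp 1 ^ (k + 1) := Real.exp_nat_mul 1 (k + 1)
      _ ≤ 3 ^ (k + 1) := pow_le_pow_left₀ (Real.exp_pos 1).le Real.exp_one_lt_three.le _
  have hmom : 12 * ((2 * ((k : ℝ) + 1) * (2 * Δ * D)) ^ k * (6 * m * D)) ≤ l ^ (2 * (k + 1)) := by
    have h72 : (72 : ℝ) ≤ 72 ^ (k + 1) := le_self_pow₀ (by norm_num) (Nat.succ_ne_zero k)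
    have hDle : (D : ℝ) ≤ 4 * (k + 1) * (Δ * D) := by
      have h1 : (1 : ℝ) ≤ 4 * (k + 1) * Δ := by
        have : (0 : ℝ) ≤ k := Nat.cast_nonneg k
        nlinarith
      nlinarith
    rw [pow_mul, hl, Real.sq_sqrt (by positivity)]
    calc 12 * ((2 * ((k : ℝ) + 1) * (2 * Δ * D)) ^ k * (6 * m * D))
        = (4 * (k + 1) * (Δ * D)) ^ k * D * (72 * m) := by
          rw [show 2 * ((k : ℝ) + 1) * (2 * Δ * D) = 4 * (k + 1) * (Δ * D) by ring]; ring
      _ ≤ (4 * (k + 1) * (Δ * D)) ^ k * (4 * (k + 1) * (Δ * D)) *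
          (72 ^ (k + 1) * 3 ^ (k + 1)) := by gcongr
      _ = (864 * (k + 1) * (Δ * D)) ^ (k + 1) := by
          rw [← pow_succ, ← mul_pow, ← mul_pow]; ring
  have hmain := H.mul_div_le_surplus S hl0 k (by rw [hnum, hΔ, hD]; exact hmom)
  rw [hnum] at hmain
  refine le_trans ?_ hmain
  -- Only here is `√(log m)` weakened to `(log m) ^ 2`; `6561 = 81 ^ 2`.
  have hlle : l ≤ 81 * (√((Δ : ℝ) * D) * Real.log m ^ 2) := by
    rw [hl, Real.sqrt_le_left (by positivity)]
    have h1 := Real.log_add_one_le_mul_log_pow_four hmR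
    rw [mul_pow, mul_pow, Real.sq_sqrt (by positivity)]
    have h2 : 864 * ((k : ℝ) + 1) ≤ 6561 * Real.log m ^ 4 := by linarith
    refine (mul_le_mul_of_nonneg_right h2 (by positivity)).trans (le_of_eq ?_)
    ring
  have hpos : 0 < √((Δ : ℝ) * D) * Real.log m ^ 2 := by positivity
  calc gaussianPDFReal 0 1 2 ^ 2 / 1458 * ((m : ℝ) / (√((Δ : ℝ) * D) * Real.log m ^ 2))
      = gaussianPDFReal 0 1 2 ^ 2 / (18 * (81 * (√((Δ : ℝ) * D) * Real.log m ^ 2))) * m := by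
        field_simp
        norm_num
    _ ≤ gaussianPDFReal 0 1 2 ^ 2 / (18 * l) * m := by gcongr
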